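/- Let $N,M,H$ be real $n\times n$ matrices with $[N,M]=H$, $[H,N]=2N$, $[H,M]=-2M$, and let $*$ denote transpose. For a matrix $A$ put $\mathcal D_Af(\mathbf x)=f'(\mathbf x)A\mathbf x$ for $f\in\mathbb R[[\mathbf x]]=\mathbb R[[x_1,\dots,x_n]]$ and $L_A\mathbf v(\mathbf x)=\mathbf v'(\mathbf x)A\mathbf x-A\mathbf v(\mathbf x)$ for formal vector fields $\mathbf v\in\mathbb R[[\mathbf x]]^n$. Let $\mathcal X=\mathcal D_{N^*}$, $\mathcal Y=\mathcal D_{M^*}$, $\mathcal Z=\mathcal D_{H^*}$, let $\mathcal J=\ker\mathcal X$ be the algebra of formal invariants, and let $\mathcal E=\ker L_{N^*}$ be the space of formal equivariants. A family of elements of $\mathcal J$ (or of $\mathcal E$) is a *formal basis* of that space if it is linearly independent and every element of the space is, in exactly one way, a formal (possibly infinite) linear combination of the family; in such a combination only finitely many terms contribute to each coefficient of the series. Let $\alpha=(\alpha_1,\dots,\alpha_p)$ be a Hilbert basis of $\mathcal J$: homogeneous polynomials in $\mathcal J$ that are eigenvectors of $\mathcal Z$ and generate the algebra of polynomial invariants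 $\mathcal J\cap\mathbb R[\mathbf x]$. Write $\alpha^{\mathbf k}=\alpha_1^{k_1}\cdots\alpha_p^{k_p}$. Let $A\subset\mathbb N^p$ be a standard preferred set: the $\alpha^{\mathbf k}$, $\mathbf k\in A$, form a formal basis of $\mathcal J$, and $A$ is the set of exponents of the monomials of $\mathbb R[t_1,\dots,t_p]$ that lie outside some monomial ideal. Let $\mathbf b_1,\dots,\mathbf b_q$ be a basis of $\ker N^*\subset\mathbb R^n$ consisting of eigenvectors of $-H^*$. (If $N$ is in upper Jordan form with its usual triad, one may take the standard basis vectors $\mathbf e_r$, with $r$ running over the bottom rows of the Jordan blocks.) The weight $\widehat f$ of an eigenvector $f$ of $\mathcal Z$ in $\mathcal J$ is its eigenvalue, and the weight $\widehat{\mathbf w}$ of an eigenvector $\mathbf w$ of $-H^*$ in $\ker N^*$ is its eigenvalue; these are nonnegative integers. For such $f$ and $\mathbf w$ and an integer $s\ge 0$, the transvectant $$(f,\mathbf w)^{(s)}=\sum_{j=0}^{s}(-1)^j\binom sj\frac{(\widehat f-j)!}{(\widehat f-s)!}\,\frac{(\widehat{\mathbf w}-s+j)!}{(\widehat{\mathbf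 w}-s)!}\,(\mathcal Y^jf)\,\bigl((-M^*)^{s-j}\mathbf w\bigr)$$ is *well defined* if $s\le\widehat f$ and $s\le\widehat{\mathbf w}$. A well-defined transvectant $(\alpha^{\mathbf k},\mathbf b_j)^{(s)}$ is *admissible* if $\mathbf k\in A$. The pre-box product is the family of all admissible transvectants, indexed by the triples $(\mathbf k,j,s)$. **Theorem 17.6.** Any elements $(\alpha^{\mathbf k},\mathbf b_j)^{(s)}$ of the pre-box product may be replaced by products $\alpha^{\mathbf k'}(\alpha^{\mathbf k''},\mathbf b_j)^{(s)}$, where for each replaced element $\mathbf k',\mathbf k''\in\mathbb N^p$ are chosen so that $\mathbf k'+\mathbf k''=\mathbf k$ and $(\alpha^{\mathbf k''},\mathbf b_j)^{(s)}$ is well defined. For every such choice of replacements (for some or all of the elements), the resulting family is still a formal basis of $\mathcal E$, and each remaining transvectant $(\alpha^{\mathbf k''},\mathbf b_j)^{(s)}$ is admissible. -/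

import Mathlib

open scoped Nat

noncomputable section

namespace Boosting

/-- An `sl₂` triad of real matrices: `[X, Y] = Z`, `[Z, X] = 2X`, `[Z, Y] = -2Y`.
The zero triad is allowed. -/
structure IsSl2Triad {n : ℕ} (X Y Z : Matrix (Fin n) (Fin n) ℝ) : Prop where
  comm_XY : X * Y - Y * X = Z
  comm_ZX : Z * X - X * Z = (2 : ℝ) • X
  comm_ZY : Z * Y - Y * Z = (-2 : ℝ) • Y

/-- Formal power series `ℝ[[x₁, …, xₙ]]`. -/
abbrev Series (n : ℕ) : Type := MvPowerSeries (Fin n) ℝ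

/-- Formal vector fields on `ℝⁿ`. -/
abbrev VField (n : ℕ) : Type := Fin n → Series n

/-- `𝒟_A f = f'(x) A x = ∑ i, (A x)_i ∂f/∂x_i` on formal power series. -/
def dirDeriv {n : ℕ} (A : Matrix (Fin n) (Fin n) ℝ) : Series n →ₗ[ℝ] Series n :=
  ((∑ i, (∑ j, A i j • (MvPowerSeries.X j : Series n)) • MvPowerSeries.pderiv ℝ i :
    Derivation ℝ (Series n) (Series n)) : Series n →ₗ[ℝ] Series n)

/-- `L_A v = v'(x) A x - A v(x)` on formal vector fields. -/
def lieDeriv {n : ℕ} (A : Matrix (Fin n) (Fin n) ℝ) : VField n →ₗ[ℝ] VField n :=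
  LinearMap.pi fun r =>
    dirDeriv A ∘ₗ LinearMap.proj r - ∑ c, A r c • (LinearMap.proj c : VField n →ₗ[ℝ] Series n)

/-- The formal invariants `𝒥 = ker 𝒟_{N*}`, where `N*` is the transpose of `N`. -/
def invariants {n : ℕ} (N : Matrix (Fin n) (Fin n) ℝ) : Submodule ℝ (Series n) :=
  LinearMap.ker (dirDeriv N.transpose)

/-- The formal equivariants `ℰ = ker L_{N*}`. -/
def equivariants {n : ℕ} (N : Matrix (Fin n) (Fin n) ℝ) : Submodule ℝ (VField n) :=
  LinearMap.ker (lieDeriv N.transpose)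

/-- The coefficient functionals of a formal power series. -/
def seriesCoeff (n : ℕ) (m : Fin n →₀ ℕ) : Series n →ₗ[ℝ] ℝ := MvPowerSeries.coeff m

/-- The coefficient functionals of a formal vector field: component and monomial. -/
def fieldCoeff (n : ℕ) (rm : Fin n × (Fin n →₀ ℕ)) : VField n →ₗ[ℝ] ℝ :=
  MvPowerSeries.coeff rm.2 ∘ₗ LinearMap.proj rm.1

/-- `f = ∑ i, c i • v i` as a possibly infinite formal sum: every coefficient `coef κ` receives
only finitely many nonzero contributions, and these add up to the coefficient of `f`. -/
def IsFormalSum {V K I : Type*} [AddCommGroup V] [Module ℝ V] (coef : K → V →ₗ[ℝ] ℝ)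
    (v : I → V) (c : I → ℝ) (f : V) : Prop :=
  ∀ κ, {i | c i * coef κ (v i) ≠ 0}.Finite ∧ coef κ f = ∑ᶠ i, c i * coef κ (v i)

/-- The family `v` is a formal vector space basis of `W`: it lies in `W`, it is linearly
independent, and every element of `W` has an expansion, and only one, as a formal (countable)
linear combination of the family. For a linearly independent family of homogeneous elements
uniqueness is automatic. -/
structure IsFormalBasis {V K I : Type*} [AddCommGroup V] [Module ℝ V] (coef : K → V →ₗ[ℝ] ℝ)
    (W : Submodule ℝ V) (v : I → V) : Prop where
  mem : ∀ i, v i ∈ W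
  linearIndependent : LinearIndependent ℝ v
  expansion : ∀ f ∈ W, ∃! c : I → ℝ, IsFormalSum coef v c f

/-- The weight of a weight vector `v` of `Z`, that is, its eigenvalue. Top weight vectors of the
triads used below have natural numbers as weights; where there is none, the value is `0`. -/
def weight {V : Type*} [AddCommGroup V] [Module ℝ V] (Z : V →ₗ[ℝ] V) (v : V) : ℕ :=
  sInf {w : ℕ | Z v = (w : ℝ) • v}

/-- The weight of a formal power series under `𝒵 = 𝒟_{H*}`. -/
def seriesWeight {n : ℕ} (H : Matrix (Fin n) (Fin n) ℝ) (f : Series n) : ℕ :=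
  weight (dirDeriv H.transpose) f

/-- The weight of a vector of `ℝⁿ` under `-H*`, the third element of the triad
`(-N*, -M*, -H*)`. -/
def vecWeight {n : ℕ} (H : Matrix (Fin n) (Fin n) ℝ) (w : Fin n → ℝ) : ℕ :=
  weight (-H.transpose).mulVecLin w

/-- `α = (α₁, …, α_p)` is a Hilbert basis: each `α i` is a homogeneous polynomial, an invariant
and a (nonzero) weight vector of `𝒵 = 𝒟_{H*}`, and every polynomial invariant is a polynomial
in `α`. -/
structure IsHilbertBasis {n p : ℕ} (N H : Matrix (Fin n) (Fin n) ℝ)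
    (α : Fin p → MvPolynomial (Fin n) ℝ) : Prop where
  homogeneous : ∀ i, ∃ d, (α i).IsHomogeneous d
  invariant : ∀ i, (α i : Series n) ∈ invariants N
  weightVector : ∀ i, ∃ w : ℝ,
    Module.End.HasEigenvector (dirDeriv H.transpose) w (α i : Series n)
  generates : ∀ f : MvPolynomial (Fin n) ℝ, (f : Series n) ∈ invariants N →
    f ∈ Algebra.adjoin ℝ (Set.range α)

/-- The monomial `α^k = α₁^{k₁} ⋯ α_p^{k_p}`, as a formal power series in `x`. -/
def mono {n p : ℕ} (α : Fin p → MvPolynomial (Fin n) ℝ) (k : Fin p →₀ ℕ) : Series n :=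
  ((∏ i, α i ^ k i : MvPolynomial (Fin n) ℝ) : Series n)

/-- `A` (a set of exponents) is a preferred set: the `α^k` with `k ∈ A` form a formal vector
space basis of the invariants. -/
def IsPreferredSet {n p : ℕ} (N : Matrix (Fin n) (Fin n) ℝ)
    (α : Fin p → MvPolynomial (Fin n) ℝ) (A : Set (Fin p →₀ ℕ)) : Prop :=
  IsFormalBasis (seriesCoeff n) (invariants N) fun k : A => mono α k.1

/-- `A` (a set of exponents) is standard: it consists of the exponents of all monomials outside
some monomial ideal of `ℝ[t₁, …, t_p]`. -/
def IsStandardSet {p : ℕ} (A : Set (Fin p →₀ ℕ)) : Prop :=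
  ∃ S : Set (Fin p →₀ ℕ), A = {k | MvPolynomial.monomial k (1 : ℝ) ∉
    Ideal.span ((fun m => MvPolynomial.monomial m (1 : ℝ)) '' S)}

/-- `b = (b₁, …, b_q)` is a basis of `ker N*` consisting of weight vectors of `-H*`. When `N` is
in upper Jordan form with the usual `M` and `H`, the standard basis vectors `e_r`, where `r` runs
over the bottom rows of the Jordan blocks, form such a basis. -/
structure IsTopBasis {n q : ℕ} (N H : Matrix (Fin n) (Fin n) ℝ) (b : Fin q → Fin n → ℝ) :
    Prop where
  linearIndependent : LinearIndependent ℝ b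
  span_eq : Submodule.span ℝ (Set.range b) = LinearMap.ker N.transpose.mulVecLin
  weightVector : ∀ j, ∃ w : ℝ,
    Module.End.HasEigenvector (-H.transpose).mulVecLin w (b j)

/-- The transvectant `(f, w)^(s)` is well defined if `s` is at most both weights. -/
def WellDefined {n : ℕ} (H : Matrix (Fin n) (Fin n) ℝ) (f : Series n) (w : Fin n → ℝ)
    (s : ℕ) : Prop :=
  s ≤ seriesWeight H f ∧ s ≤ vecWeight H w

/-- The coefficient `W^{sj} = (s choose j) · (a - j)!/(a - s)! · (b - s + j)!/(b - s)!`, used for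
`j ≤ s ≤ a` and `s ≤ b` only. -/
def transCoeff (a b s j : ℕ) : ℝ :=
  (s.choose j : ℝ) * (((a - j)! : ℝ) / ((a - s)! : ℝ)) * (((b - s + j)! : ℝ) / ((b - s)! : ℝ))

/-- The external transvectant
`(f, w)^(s) = ∑_{j=0}^{s} (-1)^j W^{sj} (𝒴^j f) ((-M*)^{s-j} w)` with `𝒴 = 𝒟_{M*}`. -/
def transvectant {n : ℕ} (M H : Matrix (Fin n) (Fin n) ℝ) (f : Series n) (w : Fin n → ℝ)
    (s : ℕ) : VField n :=
  ∑ j ∈ Finset.range (s + 1),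
    ((-1 : ℝ) ^ j * transCoeff (seriesWeight H f) (vecWeight H w) s j) •
      fun r => (((-M.transpose) ^ (s - j)).mulVec w r) •
        ((dirDeriv M.transpose)^[j] f)

/-- The data `(k, j, s)` of a transvectant `(α^k, b_j)^(s)`. -/
structure Label (p q : ℕ) where
  exponent : Fin p →₀ ℕ
  index : Fin q
  strength : ℕ

/-- `(α^k, b_j)^(s)` is an admissible transvectant: it is well defined and `k ∈ A`. -/
structure IsAdmissible {n p q : ℕ} (H : Matrix (Fin n) (Fin n) ℝ)
    (α : Fin p → MvPolynomial (Fin n) ℝ) (A : Set (Fin p →₀ ℕ)) (b : Fin q → Fin n → ℝ)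
    (τ : Label p q) : Prop where
  wellDefined : WellDefined H (mono α τ.exponent) (b τ.index) τ.strength
  mem : τ.exponent ∈ A

/-- The pre-box product: all admissible transvectants, given by their data. -/
def preBox {n p q : ℕ} (H : Matrix (Fin n) (Fin n) ℝ)
    (α : Fin p → MvPolynomial (Fin n) ℝ) (A : Set (Fin p →₀ ℕ)) (b : Fin q → Fin n → ℝ) :
    Set (Label p q) :=
  {τ | IsAdmissible H α A b τ}

end Boosting

end

/-! The operator `-N*`, applied to the values of a vector field, is nilpotent and filters the
equivariants. Applying `(-N*)^s` to `(f, w)^(s)` kills every term except `j = 0` and leaves a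
nonzero multiple of `f w`; a higher power gives zero. Multiplication by a series commutes with
constant matrices, so `α^{k'} (α^{k''}, b_j)^(s)` has, up to a nonzero factor, the same leading term
`α^k b_j` as `(α^k, b_j)^(s)`. Any homogeneous equivariants with these leading terms form a formal
basis. An element left in place is the case `k' = 0`.

Independence (`linearIndependent_of_leading`): in a relation, the terms of greatest strength reduce
to a relation among the `α^k b_j`.

Spanning (`mem_span_of_leading`): if `(-N*)^(s+1) v = 0`, then `u = (-N*)^s v` has values in `ker
N*`, so `u = ∑ f_j b_j` with invariants `f_j`. By equivariance `f_j` lies in the range of `𝒳^s`, and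
the values of `u` lie in the range of `(-N*)^s`. By `le_weight_of_mem_range_pow`, proved with the
Casimir operator, only weights at least `s` occur on either side. Hence `u` is a combination of
leading terms of admissible transvectants; subtracting these lowers `s`.

Admissibility of the remaining transvectants holds because a standard set is closed under divisors.
-/

noncomputable section

namespace Boosting

/-! ### Triads of operators: nilpotency, weights and the Casimir operator -/

section Abstract

open Polynomial

variable {V : Type*} [AddCommGroup V] [Module ℝ V]

/-- An `sl₂` triad of linear operators. -/
structure IsOpTriad (X Y Z : Module.End ℝ V) : Prop where
  comm_XY : X * Y - Y * X = Z
  comm_ZX : Z * X - X * Z = (2 : ℝ) • X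
  comm_ZY : Z * Y - Y * Z = (-2 : ℝ) • Y

/-- The Casimir operator of a triad. -/
def casimir (Y X Z : Module.End ℝ V) : Module.End ℝ V :=
  (4 : ℝ) • (Y * X) + Z * Z + (2 : ℝ) • Z

theorem casimir_apply (X Y Z : Module.End ℝ V) (v : V) :
    casimir Y X Z v = (4 : ℝ) • Y (X v) + Z (Z v) + (2 : ℝ) • Z v := by
  simp [casimir]

/-- Bracketing with `Z` multiplies `X ^ k` by `c * k`. If no power vanished, these would be
eigenvectors for infinitely many distinct eigenvalues on a finite-dimensional space. -/
theorem isNilpotent_of_commutator_eq_smul [FiniteDimensional ℝ V] {X Z : Module.End ℝ V} {c : ℝ}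
    (hc : c ≠ 0) (h : Z * X - X * Z = c • X) : IsNilpotent X := by
  by_contra hX
  have hne : ∀ k, X ^ k ≠ 0 := fun k hk => hX ⟨k, hk⟩
  let T : Module.End ℝ (Module.End ℝ V) := LinearMap.mulLeft ℝ Z - LinearMap.mulRight ℝ Z
  have hT : ∀ k : ℕ, T (X ^ k) = (c * k) • X ^ k := by
    intro k
    simp only [T, LinearMap.sub_apply, LinearMap.mulLeft_apply, LinearMap.mulRight_apply]
    induction k with
    | zero => simp
    | succ k ih =>
      have : Z * X ^ (k + 1) - X ^ (k + 1) * Z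
          = (Z * X ^ k - X ^ k * Z) * X + X ^ k * (Z * X - X * Z) := by
        rw [pow_succ]; noncomm_ring
      rw [this, ih, h, smul_mul_assoc, mul_smul_comm, ← pow_succ, ← add_smul]
      push_cast
      ring_nf
  have hli := Module.End.eigenvectors_linearIndependent' T (fun k : ℕ => c * k)
    (fun a b hab => by simpa [hc] using hab) (fun k => X ^ k)
    (fun k => ⟨Module.End.mem_eigenspace_iff.2 (hT k), hne k⟩)
  have := hli.finite
  exact not_finite ℕ

theorem commute_aeval {S T : Module.End ℝ V} (hST : Commute S T) (P : ℝ[X]) :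
    Commute S (aeval T P) := by
  induction P using Polynomial.induction_on' with
  | add p q hp hq => rw [map_add]; exact hp.add_right hq
  | monomial k a =>
    rw [aeval_monomial]
    exact Commute.mul_right (Algebra.commutes a S).symm (hST.pow_right k)

namespace IsOpTriad

variable {X Y Z : Module.End ℝ V} (h : IsOpTriad X Y Z)
include h

theorem XY (v : V) : X (Y v) = Y (X v) + Z v := by
  rw [← h.comm_XY]; simp

theorem ZX (v : V) : Z (X v) = X (Z v) + (2 : ℝ) • X v := by
  have := LinearMap.congr_fun h.comm_ZX v
  simp only [LinearMap.sub_apply, Module.End.mul_apply, LinearMap.smul_apply] at this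
  rw [← this]; abel

theorem ZY (v : V) : Z (Y v) = Y (Z v) - (2 : ℝ) • Y v := by
  have := LinearMap.congr_fun h.comm_ZY v
  simp only [LinearMap.sub_apply, Module.End.mul_apply, LinearMap.smul_apply] at this
  rw [sub_eq_iff_eq_add] at this
  rw [this, neg_smul]; abel

theorem Z_pow_Y {e : V} {m : ℝ} (hZ : Z e = m • e) (j : ℕ) :
    Z ((Y ^ j) e) = (m - 2 * j) • (Y ^ j) e := by
  induction j with
  | zero => simp [hZ]
  | succ j ih =>
    rw [pow_succ', Module.End.mul_apply, h.ZY, ih, map_smul, ← sub_smul]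
    push_cast
    ring_nf

theorem X_pow_Y {e : V} {m : ℝ} (hX : X e = 0) (hZ : Z e = m • e) (j : ℕ) :
    X ((Y ^ (j + 1)) e) = ((j + 1) * (m - j)) • (Y ^ j) e := by
  induction j with
  | zero => simp [h.XY, hX, hZ]
  | succ j ih =>
    rw [pow_succ', Module.End.mul_apply, h.XY, ih, map_smul, h.Z_pow_Y hZ, ← Module.End.mul_apply,
      ← pow_succ', ← add_smul]
    push_cast
    ring_nf

theorem pow_X_pow_Y_self {e : V} {m : ℝ} (hX : X e = 0) (hZ : Z e = m • e) (s : ℕ) :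
    (X ^ s) ((Y ^ s) e) = (∏ j ∈ Finset.range s, (((j : ℝ) + 1) * (m - j))) • e := by
  induction s with
  | zero => simp
  | succ s ih =>
    rw [pow_succ X, Module.End.mul_apply, h.X_pow_Y hX hZ, map_smul, ih, smul_smul,
      Finset.prod_range_succ, mul_comm]

theorem pow_X_pow_Y_of_lt {e : V} {m : ℝ} (hX : X e = 0) (hZ : Z e = m • e) {i s : ℕ}
    (his : i < s) : (X ^ s) ((Y ^ i) e) = 0 := by
  obtain ⟨t, rfl⟩ := Nat.exists_eq_add_of_lt his
  rw [show i + t + 1 = t + 1 + i by ring, pow_add, Module.End.mul_apply,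
    h.pow_X_pow_Y_self hX hZ, map_smul, pow_succ, Module.End.mul_apply, hX]
  simp

/-- If `Y ^ k e` is the last nonzero vector of the string below `e`, then applying `X` to `Y ^ (k +
1) e = 0` gives `(k + 1) (w - k) = 0`. -/
theorem exists_nat_weight {e : V} {w : ℝ} {a : ℕ} (he : e ≠ 0) (hX : X e = 0) (hZ : Z e = w • e)
    (hY : (Y ^ a) e = 0) : ∃ m : ℕ, w = m := by
  classical
  have hex : ∃ a, (Y ^ a) e = 0 := ⟨a, hY⟩
  obtain ⟨k, hk⟩ : ∃ k, Nat.find hex = k + 1 := by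
    refine Nat.exists_eq_succ_of_ne_zero fun h0 => he ?_
    simpa [h0] using Nat.find_spec hex
  have h1 : (Y ^ (k + 1)) e = 0 := hk ▸ Nat.find_spec hex
  have h2 : (Y ^ k) e ≠ 0 := Nat.find_min hex (by omega)
  have h3 := h.X_pow_Y hX hZ k
  rw [h1, map_zero, eq_comm, smul_eq_zero, or_iff_left h2, mul_eq_zero] at h3
  refine ⟨k, ?_⟩
  rcases h3 with h3 | h3
  · have : (0 : ℝ) < k + 1 := by positivity
    linarith
  · linarith

/-- This is `[X^(j+1), Y] = (j + 1) (Z - j) X^j`. No weight vector is involved, so it applies to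
arbitrary elements of the range of a power of `X`. -/
theorem pow_X_Y (j : ℕ) (v : V) : (X ^ (j + 1)) (Y v) =
    Y ((X ^ (j + 1)) v) + ((j : ℝ) + 1) • (Z ((X ^ j) v) - (j : ℝ) • (X ^ j) v) := by
  induction j with
  | zero => simp [h.XY]
  | succ j ih =>
    rw [pow_succ' X (j + 1), Module.End.mul_apply, ih, map_add, map_smul, map_sub, map_smul, h.XY,
      ← Module.End.mul_apply X (X ^ j), ← pow_succ', ← Module.End.mul_apply X (X ^ (j + 1)),
      ← pow_succ']
    have hz : X (Z ((X ^ j) v)) = Z ((X ^ (j + 1)) v) - (2 : ℝ) • (X ^ (j + 1)) v := by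
      rw [pow_succ' X j, Module.End.mul_apply, h.ZX]; abel
    rw [hz]
    push_cast
    module

theorem casimir_comm_X : Commute (casimir Y X Z) X := by
  refine LinearMap.ext fun v => ?_
  simp only [Module.End.mul_apply, casimir_apply, map_add, map_smul, h.XY, h.ZX]
  module

theorem casimir_comm_Y : Commute (casimir Y X Z) Y := by
  refine LinearMap.ext fun v => ?_
  simp only [Module.End.mul_apply, casimir_apply, map_add, map_smul, map_sub, h.XY, h.ZY]
  module

/-- On a `Y`-invariant subspace `U` with `X ^ a = 0`, the operator
`∏_{s ≤ i < a} (C - i (i + 2))`, with `C` the Casimir operator, is annihilated by `X ^ s`. -/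
theorem pow_X_aeval_casimir {U : Submodule ℝ V} (hUY : ∀ u ∈ U, Y u ∈ U) {a : ℕ}
    (ha : ∀ u ∈ U, (X ^ a) u = 0) (s : ℕ) :
    ∀ u ∈ U, (X ^ s) (aeval (casimir Y X Z)
      (∏ i ∈ Finset.Ico s a, (Polynomial.X - C ((i : ℝ) * (i + 2)))) u) = 0 := by
  rcases le_total a s with has | hsa
  · intro u hu
    obtain ⟨t, rfl⟩ := Nat.exists_eq_add_of_le has
    rw [Finset.Ico_eq_empty (by omega), Finset.prod_empty, map_one, Module.End.one_apply, add_comm,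
      pow_add, Module.End.mul_apply, ha u hu, map_zero]
  induction hsa using Nat.decreasingInduction with
  | self => intro u hu; simpa using ha u hu
  | of_succ j hj ih =>
    intro u hu
    rw [← Finset.prod_Ioo_mul_eq_prod_Ico hj, Finset.Ico_add_one_left_eq_Ioo] at *
    set P : ℝ[X] := ∏ i ∈ Finset.Ioo j a, (Polynomial.X - C ((i : ℝ) * (i + 2))) with hP
    set w := aeval (casimir Y X Z) P u with hw
    have h1 : (X ^ (j + 1)) w = 0 := ih u hu
    have h2 : (X ^ (j + 1)) (Y w) = 0 := by
      rw [hw, ← Module.End.mul_apply Y, (commute_aeval h.casimir_comm_Y.symm P).eq]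
      exact ih (Y u) (hUY u hu)
    -- Both `w` and `Y w` are killed by `X ^ (j + 1)`, so this identity makes `X ^ j w` a vector
    -- with `Z`-eigenvalue `j` in the kernel of `X`. There the Casimir operator is `j² + 2j`, so the
    -- new factor kills it.
    have h3 := h.pow_X_Y j w
    have hj0 : (j : ℝ) + 1 ≠ 0 := by positivity
    rw [h1, h2, map_zero, zero_add, eq_comm, smul_eq_zero, or_iff_right hj0, sub_eq_zero] at h3
    have h4 : (X ^ j) (casimir Y X Z w) = casimir Y X Z ((X ^ j) w) :=
      LinearMap.congr_fun (h.casimir_comm_X.symm.pow_left j).eq w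
    rw [mul_comm P, map_mul, Module.End.mul_apply, ← hw, map_sub, aeval_X, aeval_C,
      LinearMap.sub_apply, map_sub, h4, casimir_apply, ← Module.End.mul_apply X, ← pow_succ', h1,
      Module.algebraMap_end_apply, h3, map_smul, h3, map_zero, map_smul]
    module

/-- In an invariant subspace on which `X` is nilpotent, an element of the range of `X ^ s` that is
a combination of independent top weight vectors involves only weights at least `s`. -/
theorem le_weight_of_mem_range_pow {U : Submodule ℝ V} (hUY : ∀ u ∈ U, Y u ∈ U) {a : ℕ}
    (ha : ∀ u ∈ U, (X ^ a) u = 0) {I : Type*} {e : I → V} (he : LinearIndependent ℝ e)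
    (hX : ∀ i, X (e i) = 0) {m : I → ℕ} (hZ : ∀ i, Z (e i) = (m i : ℝ) • e i) {s : ℕ} {g : V}
    (hg : g ∈ U) {c : I →₀ ℝ} (hc : Finsupp.linearCombination ℝ e c = (X ^ s) g) {i : I}
    (hi : c i ≠ 0) : s ≤ m i := by
  -- The Casimir polynomial commutes with `X ^ s`, hence kills the combination, and it acts on `e i`
  -- as its value at `m i (m i + 2)`. Independence forces this value to vanish when `c i ≠ 0`, so `m
  -- i` is one of the integers in `[s, a)`.
  have h0 := h.pow_X_aeval_casimir hUY ha s g hg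
  set P : ℝ[X] := ∏ i ∈ Finset.Ico s a, (Polynomial.X - C ((i : ℝ) * (i + 2))) with hP
  have hcomm := commute_aeval (h.casimir_comm_X.symm.pow_left s) P
  rw [← Module.End.mul_apply, hcomm.eq, Module.End.mul_apply, ← hc,
    Finsupp.linearCombination_apply, Finsupp.sum, map_sum] at h0
  have hT : ∀ i, aeval (casimir Y X Z) P (e i) = P.eval ((m i : ℝ) * (m i + 2)) • e i := by
    intro i
    refine Module.End.aeval_apply_of_hasEigenvector ⟨Module.End.mem_eigenspace_iff.2 ?_, he.ne_zero i⟩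
    rw [casimir_apply, hX, hZ, map_smul, hZ, map_zero]
    module
  have h1 := linearIndependent_iff'.1 he c.support
    (fun i => c i * P.eval ((m i : ℝ) * (m i + 2)))
    (by simpa only [map_smul, hT, smul_smul] using h0) i (Finsupp.mem_support_iff.2 hi)
  rw [mul_eq_zero, or_iff_right hi, hP, eval_prod, Finset.prod_eq_zero_iff] at h1
  obtain ⟨t, ht, h2⟩ := h1
  simp only [eval_sub, eval_X, eval_C] at h2
  have h3 : m i * (m i + 2) = t * (t + 2) := by exact_mod_cast sub_eq_zero.1 h2
  have h4 : m i = t := by nlinarith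
  rw [h4]
  exact (Finset.mem_Ico.1 ht).1

/-- Span form of `le_weight_of_mem_range_pow`. -/
theorem mem_span_of_mem_range_pow {U : Submodule ℝ V} (hUY : ∀ u ∈ U, Y u ∈ U) {a : ℕ}
    (ha : ∀ u ∈ U, (X ^ a) u = 0) {I : Type*} {e : I → V} (he : LinearIndependent ℝ e)
    (hX : ∀ i, X (e i) = 0) {m : I → ℕ} (hZ : ∀ i, Z (e i) = (m i : ℝ) • e i) {s : ℕ} {g : V}
    (hg : g ∈ U) (hspan : (X ^ s) g ∈ Submodule.span ℝ (Set.range e)) :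
    (X ^ s) g ∈ Submodule.span ℝ (e '' {i | s ≤ m i}) := by
  obtain ⟨c, hc⟩ := (Finsupp.mem_span_range_iff_exists_finsupp).1 hspan
  rw [← hc]
  refine Submodule.sum_mem _ fun i hi => Submodule.smul_mem _ _ (Submodule.subset_span ⟨i, ?_, rfl⟩)
  exact h.le_weight_of_mem_range_pow hUY ha he hX hZ hg hc (Finsupp.mem_support_iff.1 hi)

end IsOpTriad

end Abstract

/-! ### Formal bases and finite-dimensional graded pieces -/

section Graded

variable {V K I : Type*} [AddCommGroup V] [Module ℝ V]

/-- The elements of `V` whose nonzero coefficients all have degree `d`. -/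
def gradedPart (coef : K → V →ₗ[ℝ] ℝ) (dg : K → ℕ) (d : ℕ) : Submodule ℝ V :=
  ⨅ κ : {κ // dg κ ≠ d}, LinearMap.ker (coef κ)

variable {coef : K → V →ₗ[ℝ] ℝ} {dg : K → ℕ}

theorem mem_gradedPart {d : ℕ} {f : V} :
    f ∈ gradedPart coef dg d ↔ ∀ κ, dg κ ≠ d → coef κ f = 0 := by
  simp [gradedPart, Submodule.mem_iInf]

theorem finiteDimensional_gradedPart (hsep : ∀ f g : V, (∀ κ, coef κ f = coef κ g) → f = g)
    {d : ℕ} (hfin : {κ | dg κ = d}.Finite) : FiniteDimensional ℝ (gradedPart coef dg d) := by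
  have := hfin.to_subtype
  let ev : gradedPart coef dg d →ₗ[ℝ] ({κ | dg κ = d} → ℝ) :=
    LinearMap.pi fun κ => coef κ.1 ∘ₗ (gradedPart coef dg d).subtype
  refine Module.Finite.of_injective ev fun f g hfg => Subtype.ext (hsep _ _ fun κ => ?_)
  by_cases hκ : dg κ = d
  · exact congrFun hfg ⟨κ, hκ⟩
  · rw [mem_gradedPart.1 f.2 κ hκ, mem_gradedPart.1 g.2 κ hκ]

variable {v : I → V} {deg : I → ℕ}

theorem finite_setOf_deg_eq (hli : LinearIndependent ℝ v)
    (hdeg : ∀ i, v i ∈ gradedPart coef dg (deg i)) (d : ℕ)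
    [FiniteDimensional ℝ (gradedPart coef dg d)] : {i | deg i = d}.Finite := by
  let u : {i | deg i = d} → gradedPart coef dg d := fun i => ⟨v i.1, by
    have h := hdeg i.1
    rwa [show deg i.1 = d from i.2] at h⟩
  have hu : LinearIndependent ℝ u :=
    LinearIndependent.of_comp (gradedPart coef dg d).subtype
      (hli.comp (Subtype.val : {i | deg i = d} → I) Subtype.val_injective)
  have := hu.finite
  exact Set.toFinite _

/-- The homogeneous part of degree `d` of a formal combination of homogeneous elements. -/
theorem coef_eq_sum_of_isFormalSum (hdeg : ∀ i, v i ∈ gradedPart coef dg (deg i)) {c : I → ℝ}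
    {f : V} (hf : IsFormalSum coef v c f) (F : Finset I) {d : ℕ} (hF : ∀ i, deg i = d → i ∈ F)
    {κ : K} (hκ : dg κ = d) : coef κ f = coef κ (∑ i ∈ F, c i • v i) := by
  rw [(hf κ).2, finsum_eq_sum_of_support_subset (s := F), map_sum]
  · simp
  · intro i hi
    refine hF i (by_contra fun hne => hi ?_)
    simp only
    rw [mem_gradedPart.1 (hdeg i) κ (fun h => hne (h.symm.trans hκ)), mul_zero]

/-- In degree `d` only the finitely many family members of degree `d` contribute. Truncating the
formal expansion to them changes nothing, since `f` has no coefficients in other degrees. -/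
theorem mem_span_of_isFormalBasis (hsep : ∀ f g : V, (∀ κ, coef κ f = coef κ g) → f = g)
    {W : Submodule ℝ V} (hv : IsFormalBasis coef W v)
    (hdeg : ∀ i, v i ∈ gradedPart coef dg (deg i)) (d : ℕ)
    [FiniteDimensional ℝ (gradedPart coef dg d)] {f : V} (hfW : f ∈ W)
    (hf : f ∈ gradedPart coef dg d) : f ∈ Submodule.span ℝ (v '' {i | deg i = d}) := by
  have hfin := finite_setOf_deg_eq hv.linearIndependent hdeg d
  obtain ⟨c, hc, -⟩ := hv.expansion f hfW
  have hin : ∑ i ∈ hfin.toFinset, c i • v i ∈ gradedPart coef dg d :=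
    Submodule.sum_mem _ fun i hi => Submodule.smul_mem _ _ ((hfin.mem_toFinset.1 hi : _ = _) ▸ hdeg i)
  have : f = ∑ i ∈ hfin.toFinset, c i • v i := by
    refine hsep _ _ fun κ => ?_
    by_cases hκ : dg κ = d
    · exact coef_eq_sum_of_isFormalSum hdeg hc _ (fun i hi => hfin.mem_toFinset.2 hi) hκ
    · rw [mem_gradedPart.1 hf κ hκ, mem_gradedPart.1 hin κ hκ]
  rw [this]
  exact Submodule.sum_mem _ fun i hi =>
    Submodule.smul_mem _ _ (Submodule.subset_span ⟨i, hfin.mem_toFinset.1 hi, rfl⟩)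

/-- An independent homogeneous family that spans a graded subspace in every degree is a formal
basis of it. -/
theorem isFormalBasis_of_span (hsep : ∀ f g : V, (∀ κ, coef κ f = coef κ g) → f = g)
    [∀ d, FiniteDimensional ℝ (gradedPart coef dg d)] {W : Submodule ℝ V}
    (hcomp : ∀ f ∈ W, ∀ d, ∃ g ∈ W, g ∈ gradedPart coef dg d ∧
      ∀ κ, dg κ = d → coef κ g = coef κ f)
    (hdeg : ∀ i, v i ∈ gradedPart coef dg (deg i)) (hmem : ∀ i, v i ∈ W)
    (hli : LinearIndependent ℝ v)
    (hspan : ∀ d, ∀ f ∈ W, f ∈ gradedPart coef dg d →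
      f ∈ Submodule.span ℝ (v '' {i | deg i = d})) : IsFormalBasis coef W v where
  mem := hmem
  linearIndependent := hli
  expansion f hf := by
    classical
    have hfin := fun d => finite_setOf_deg_eq hli hdeg d
    have hex : ∀ d, ∃ c : I → ℝ, ∀ κ, dg κ = d →
        coef κ f = coef κ (∑ i ∈ (hfin d).toFinset, c i • v i) := by
      intro d
      obtain ⟨g, hgW, hgd, hg⟩ := hcomp f hf d
      have h1 := hspan d g hgW hgd
      obtain ⟨l, hl, hlg⟩ := (Finsupp.mem_span_image_iff_linearCombination ℝ).1 h1
      refine ⟨l, fun κ hκ => ?_⟩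
      rw [← hg κ hκ, ← hlg, Finsupp.linearCombination_apply,
        Finsupp.sum_of_support_subset l (s := (hfin d).toFinset) _ _ (by simp)]
      exact fun i hi => (hfin d).mem_toFinset.2 ((Finsupp.mem_supported ℝ l).1 hl hi)
    choose c hc using hex
    have hsum : ∀ (c : I → ℝ) κ, {i | c i * coef κ (v i) ≠ 0} ⊆ (hfin (dg κ)).toFinset := by
      intro c κ i hi
      refine (hfin (dg κ)).mem_toFinset.2 (by_contra fun hne => hi ?_)
      rw [mem_gradedPart.1 (hdeg i) κ (fun h => hne h.symm), mul_zero]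
    -- The coefficient of `v i` is read off from the expansion of the homogeneous part of degree
    -- `deg i`.
    refine ⟨fun i => c (deg i) i, fun κ => ⟨(Finset.finite_toSet _).subset (hsum _ κ), ?_⟩, ?_⟩
    · rw [finsum_eq_sum_of_support_subset _ (hsum _ κ), hc _ κ rfl, map_sum]
      refine Finset.sum_congr rfl fun i hi => ?_
      rw [show deg i = dg κ from (hfin (dg κ)).mem_toFinset.1 hi, map_smul, smul_eq_mul]
    · intro c' hc'
      funext i
      -- In the degree of `v i`, two expansions differ by a finite linear relation.
      have hzero : ∑ j ∈ (hfin (deg i)).toFinset, (c' j - c (deg i) j) • v j = 0 := by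
        refine hsep _ _ fun κ => ?_
        rw [map_zero]
        by_cases hκ : dg κ = deg i
        · have h1 := coef_eq_sum_of_isFormalSum hdeg hc' _
            (fun j hj => (hfin (deg i)).mem_toFinset.2 hj) hκ
          simp only [sub_smul, Finset.sum_sub_distrib, map_sub]
          rw [← h1, ← hc _ κ hκ, sub_self]
        · refine mem_gradedPart.1 (Submodule.sum_mem _ fun j hj => Submodule.smul_mem _ _ ?_) κ hκ
          exact ((hfin (deg i)).mem_toFinset.1 hj : _ = _) ▸ hdeg j
      exact sub_eq_zero.1 (linearIndependent_iff'.1 hli _ _ hzero i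
        ((hfin (deg i)).mem_toFinset.2 rfl))

end Graded

/-! ### Linear derivations of formal power series -/

section Fields

open MvPowerSeries

variable {n : ℕ}

theorem dirDeriv_apply (A : Matrix (Fin n) (Fin n) ℝ) (f : Series n) :
    dirDeriv A f = ∑ i, (∑ j, A i j • (X j : Series n)) * pderiv ℝ i f := by
  have h := congrFun (map_sum (Derivation.coeFnAddMonoidHom (R := ℝ) (A := Series n)
    (M := Series n)) (fun i => (∑ j, A i j • (X j : Series n)) • pderiv ℝ i) Finset.univ) f
  rw [Finset.sum_apply] at h
  exact h

theorem dirDeriv_mul (A : Matrix (Fin n) (Fin n) ℝ) (f g : Series n) :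
    dirDeriv A (f * g) = f * dirDeriv A g + g * dirDeriv A f := by
  simp only [dirDeriv, Derivation.coeFn_coe, Derivation.leibniz, smul_eq_mul]

theorem dirDeriv_one (A : Matrix (Fin n) (Fin n) ℝ) : dirDeriv A (1 : Series n) = 0 := by
  simp only [dirDeriv, Derivation.coeFn_coe, Derivation.map_one_eq_zero]

theorem dirDeriv_sub (A B : Matrix (Fin n) (Fin n) ℝ) (f : Series n) :
    dirDeriv (A - B) f = dirDeriv A f - dirDeriv B f := by
  simp only [dirDeriv_apply, Matrix.sub_apply, sub_smul, Finset.sum_sub_distrib, sub_mul]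

theorem dirDeriv_smul (c : ℝ) (A : Matrix (Fin n) (Fin n) ℝ) (f : Series n) :
    dirDeriv (c • A) f = c • dirDeriv A f := by
  simp only [dirDeriv_apply, Matrix.smul_apply, smul_assoc, ← Finset.smul_sum, smul_mul_assoc]

theorem pderiv_comm (i j : Fin n) (f : Series n) :
    pderiv ℝ i (pderiv ℝ j f) = pderiv ℝ j (pderiv ℝ i f) := by
  ext m
  simp only [coeff_pderiv, add_right_comm m, Finsupp.add_apply]
  by_cases hij : i = j
  · subst hij; rfl
  · simp [hij, Ne.symm hij]
    ring

theorem pderiv_linear (B : Matrix (Fin n) (Fin n) ℝ) (i j : Fin n) :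
    pderiv ℝ i (∑ k, B j k • (X k : Series n)) = algebraMap ℝ (Series n) (B j i) := by
  simp [pderiv_X, Algebra.algebraMap_eq_smul_one, Pi.single_apply]

/-- The second-order terms are symmetric and cancel; the first-order terms give the matrix
commutator in reversed order. -/
theorem dirDeriv_commutator (A B : Matrix (Fin n) (Fin n) ℝ) (f : Series n) :
    dirDeriv A (dirDeriv B f) - dirDeriv B (dirDeriv A f) = dirDeriv (B * A - A * B) f := by
  have key : ∀ A B : Matrix (Fin n) (Fin n) ℝ, dirDeriv A (dirDeriv B f) =
      dirDeriv (B * A) f + ∑ i, ∑ j, (∑ k, A i k • (X k : Series n)) *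
        ((∑ k, B j k • (X k : Series n)) * pderiv ℝ i (pderiv ℝ j f)) := by
    intro A B
    have h1 : dirDeriv (B * A) f = ∑ i, ∑ j, (∑ k, A i k • (X k : Series n)) *
        (algebraMap ℝ (Series n) (B j i) * pderiv ℝ j f) := by
      rw [dirDeriv_apply, Finset.sum_comm]
      refine Finset.sum_congr rfl fun j _ => ?_
      simp only [Matrix.mul_apply, Finset.sum_smul, mul_smul, Algebra.algebraMap_eq_smul_one,
        smul_mul_assoc, one_mul, mul_smul_comm, Finset.sum_mul]
      rw [Finset.sum_comm]
      simp only [Finset.smul_sum]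
    rw [h1, dirDeriv_apply A, ← Finset.sum_add_distrib]
    refine Finset.sum_congr rfl fun i _ => ?_
    rw [dirDeriv_apply B, map_sum, Finset.mul_sum, ← Finset.sum_add_distrib]
    refine Finset.sum_congr rfl fun j _ => ?_
    rw [Derivation.leibniz, pderiv_linear]
    simp only [smul_eq_mul]
    ring
  rw [key A B, key B A, dirDeriv_sub]
  have : ∑ i, ∑ j, (∑ k, A i k • (X k : Series n)) *
        ((∑ k, B j k • (X k : Series n)) * pderiv ℝ i (pderiv ℝ j f)) =
      ∑ i, ∑ j, (∑ k, B i k • (X k : Series n)) *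
        ((∑ k, A j k • (X k : Series n)) * pderiv ℝ i (pderiv ℝ j f)) := by
    rw [Finset.sum_comm]
    refine Finset.sum_congr rfl fun i _ => Finset.sum_congr rfl fun j _ => ?_
    rw [pderiv_comm]; ring
  rw [this]; ring

/-- Passing to derivations and transposing both reverse commutators, so no signs appear. -/
theorem IsSl2Triad.dirDeriv {N M H : Matrix (Fin n) (Fin n) ℝ} (h : IsSl2Triad N M H) :
    IsOpTriad (V := Series n) (dirDeriv N.transpose) (dirDeriv M.transpose)
      (dirDeriv H.transpose) where
  comm_XY := by
    refine LinearMap.ext fun f => ?_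
    rw [← h.comm_XY]
    simp [dirDeriv_commutator, Matrix.transpose_mul, Matrix.transpose_sub]
  comm_ZX := by
    refine LinearMap.ext fun f => ?_
    simp only [LinearMap.sub_apply, Module.End.mul_apply, LinearMap.smul_apply,
      dirDeriv_commutator, ← Matrix.transpose_mul, ← Matrix.transpose_sub, h.comm_ZX,
      Matrix.transpose_smul, dirDeriv_smul]
  comm_ZY := by
    refine LinearMap.ext fun f => ?_
    simp only [LinearMap.sub_apply, Module.End.mul_apply, LinearMap.smul_apply,
      dirDeriv_commutator, ← Matrix.transpose_mul, ← Matrix.transpose_sub, h.comm_ZY,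
      Matrix.transpose_smul, dirDeriv_smul]

/-- Here only transposition reverses commutators, and the minus signs compensate. -/
theorem IsSl2Triad.mulVecLin {N M H : Matrix (Fin n) (Fin n) ℝ} (h : IsSl2Triad N M H) :
    IsOpTriad (V := Fin n → ℝ) (-N.transpose).mulVecLin (-M.transpose).mulVecLin
      (-H.transpose).mulVecLin where
  comm_XY := by
    rw [← h.comm_XY]
    simp only [Module.End.mul_eq_comp, ← Matrix.mulVecLin_mul, Matrix.transpose_sub,
      Matrix.transpose_mul, neg_mul_neg, neg_sub]
    refine LinearMap.ext fun v => ?_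
    simp
  comm_ZX := by
    have := congrArg Matrix.transpose h.comm_ZX
    simp only [Matrix.transpose_sub, Matrix.transpose_mul, Matrix.transpose_smul] at this
    refine LinearMap.ext fun v => ?_
    have h2 := congrArg (fun B => B.mulVec v) this
    simp only [Matrix.sub_mulVec, Matrix.smul_mulVec, ← Matrix.mulVec_mulVec] at h2
    simp only [LinearMap.sub_apply, Module.End.mul_apply, LinearMap.smul_apply,
      Matrix.mulVecLin_apply, Matrix.neg_mulVec, Matrix.mulVec_neg, neg_neg, smul_neg, ← h2]
    abel
  comm_ZY := by
    have := congrArg Matrix.transpose h.comm_ZY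
    simp only [Matrix.transpose_sub, Matrix.transpose_mul, Matrix.transpose_smul] at this
    refine LinearMap.ext fun v => ?_
    have h2 := congrArg (fun B => B.mulVec v) this
    simp only [Matrix.sub_mulVec, Matrix.smul_mulVec, ← Matrix.mulVec_mulVec] at h2
    simp only [LinearMap.sub_apply, Module.End.mul_apply, LinearMap.smul_apply,
      Matrix.mulVecLin_apply, Matrix.neg_mulVec, Matrix.mulVec_neg, neg_neg, smul_neg, ← h2]
    abel

/-- Homogeneous formal power series of degree `d`. -/
def homog (n d : ℕ) : Submodule ℝ (Series n) :=
  gradedPart (seriesCoeff n) Finsupp.degree d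

theorem mem_homog {d : ℕ} {f : Series n} :
    f ∈ homog n d ↔ ∀ m : Fin n →₀ ℕ, m.degree ≠ d → coeff m f = 0 :=
  mem_gradedPart

/-- Each `x_j ∂/∂x_i` preserves degree. In this form the fact yields both the invariance of `homog`
and the compatibility with homogeneous components. -/
theorem coeff_dirDeriv_eq_zero (A : Matrix (Fin n) (Fin n) ℝ) {d : ℕ} {f : Series n}
    (hf : ∀ m : Fin n →₀ ℕ, m.degree = d → coeff m f = 0) (m : Fin n →₀ ℕ) (hm : m.degree = d) :
    coeff m (dirDeriv A f) = 0 := by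
  classical
  rw [dirDeriv_apply, map_sum]
  refine Finset.sum_eq_zero fun i _ => ?_
  rw [Finset.sum_mul, map_sum]
  refine Finset.sum_eq_zero fun j _ => ?_
  rw [smul_mul_assoc, map_smul, X, coeff_monomial_mul]
  split_ifs with hj
  · rw [coeff_pderiv, hf, zero_mul, mul_zero, smul_zero]
    have h1 := congrArg Finsupp.degree (tsub_add_cancel_of_le hj)
    simp only [map_add, Finsupp.degree_single] at h1 ⊢
    omega
  · exact smul_zero _

theorem dirDeriv_mem_homog (A : Matrix (Fin n) (Fin n) ℝ) {d : ℕ} {f : Series n}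
    (hf : f ∈ homog n d) : dirDeriv A f ∈ homog n d := 
  mem_homog.2 fun m hm =>
    coeff_dirDeriv_eq_zero A (d := m.degree) (fun m' hm' => mem_homog.1 hf m' (hm' ▸ hm)) m rfl

theorem homogeneousComponent_mem_homog (d : ℕ) (f : Series n) :
    homogeneousComponent d f ∈ homog n d := 
  mem_homog.2 fun m hm => by rw [coeff_homogeneousComponent, if_neg hm]

theorem dirDeriv_homogeneousComponent (A : Matrix (Fin n) (Fin n) ℝ) (d : ℕ) (f : Series n) :
    dirDeriv A (homogeneousComponent d f) = homogeneousComponent d (dirDeriv A f) := by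
  ext m
  rw [coeff_homogeneousComponent]
  split_ifs with hm
  · rw [← sub_eq_zero, ← map_sub, ← map_sub]
    refine coeff_dirDeriv_eq_zero A (d := d) (fun m' hm' => ?_) m hm
    rw [map_sub, coeff_homogeneousComponent, if_pos hm', sub_self]
  · exact mem_homog.1 (dirDeriv_mem_homog A (homogeneousComponent_mem_homog d f)) m hm

instance finiteDimensional_homog (n d : ℕ) : FiniteDimensional ℝ (homog n d) :=
  finiteDimensional_gradedPart (fun _ _ => MvPowerSeries.ext) (Finsupp.finite_of_degree_eq d)

/-- Nilpotency is available only on each finite-dimensional homogeneous piece, so the exponent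
depends on `d`. -/
theorem exists_pow_dirDeriv_eq_zero {B C : Matrix (Fin n) (Fin n) ℝ} {c : ℝ} (hc : c ≠ 0)
    (h : ∀ f : Series n, dirDeriv C (dirDeriv B f) - dirDeriv B (dirDeriv C f) = c • dirDeriv B f)
    (d : ℕ) : ∃ a, ∀ f ∈ homog n d, ((dirDeriv B : Module.End ℝ (Series n)) ^ a) f = 0 := by
  have hB : ∀ f ∈ homog n d, dirDeriv B f ∈ homog n d := fun f => dirDeriv_mem_homog B
  have hC : ∀ f ∈ homog n d, dirDeriv C f ∈ homog n d := fun f => dirDeriv_mem_homog C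
  obtain ⟨a, ha⟩ := isNilpotent_of_commutator_eq_smul (X := (dirDeriv B).restrict hB)
    (Z := (dirDeriv C).restrict hC) hc (LinearMap.ext fun f => Subtype.ext (h f))
  refine ⟨a, fun f hf => ?_⟩
  have := LinearMap.congr_fun ha ⟨f, hf⟩
  rw [Module.End.pow_restrict] at this
  exact congrArg Subtype.val this

end Fields

/-! ### Formal vector fields and equivariants -/

section VectorFields

open MvPowerSeries

variable {n : ℕ}

/-- Homogeneous formal vector fields of degree `d`. -/
def fieldHomog (n d : ℕ) : Submodule ℝ (VField n) :=
  gradedPart (fieldCoeff n) (fun κ => κ.2.degree) d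

theorem mem_fieldHomog {d : ℕ} {v : VField n} :
    v ∈ fieldHomog n d ↔ ∀ r, v r ∈ homog n d := by
  simp only [fieldHomog, mem_gradedPart, Prod.forall, mem_homog]
  rfl

theorem fieldCoeff_separating (u v : VField n) (h : ∀ κ, fieldCoeff n κ u = fieldCoeff n κ v) :
    u = v :=
  funext fun r => MvPowerSeries.ext fun m => h (r, m)

instance finiteDimensional_fieldHomog (n d : ℕ) : FiniteDimensional ℝ (fieldHomog n d) := by
  refine finiteDimensional_gradedPart fieldCoeff_separating ?_
  have := Set.finite_univ.prod (s := (Set.univ : Set (Fin n)))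
    (Finsupp.finite_of_degree_eq (σ := Fin n) d)
  exact this.subset fun κ hκ => ⟨Set.mem_univ _, hκ⟩

/-- The action of a constant matrix on formal vector fields. -/
def matAct (B : Matrix (Fin n) (Fin n) ℝ) : Module.End ℝ (VField n) :=
  LinearMap.pi fun r => ∑ c, B r c • (LinearMap.proj c : VField n →ₗ[ℝ] Series n)

theorem matAct_apply (B : Matrix (Fin n) (Fin n) ℝ) (v : VField n) (r : Fin n) :
    matAct B v r = ∑ c, B r c • v c := by
  simp [matAct]

theorem lieDeriv_apply (A : Matrix (Fin n) (Fin n) ℝ) (v : VField n) (r : Fin n) :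
    lieDeriv A v r = dirDeriv A (v r) - matAct A v r := by
  simp [lieDeriv, matAct]

theorem matAct_neg (B : Matrix (Fin n) (Fin n) ℝ) (v : VField n) :
    matAct (-B) v = -matAct B v := by
  funext r
  simp [matAct_apply]

theorem mem_equivariants_iff {N : Matrix (Fin n) (Fin n) ℝ} {v : VField n} :
    v ∈ equivariants N ↔ ∀ r, matAct (-N.transpose) v r = -dirDeriv N.transpose (v r) := by
  rw [equivariants, LinearMap.mem_ker, funext_iff]
  refine forall_congr' fun r => ?_
  rw [lieDeriv_apply, matAct_neg, Pi.zero_apply, Pi.neg_apply, neg_inj, sub_eq_zero, eq_comm]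

/-- The vector of coefficients of a monomial in a formal vector field. -/
def coeffVec (m : Fin n →₀ ℕ) : VField n →ₗ[ℝ] (Fin n → ℝ) :=
  LinearMap.pi fun r => fieldCoeff n (r, m)

theorem coeffVec_apply (m : Fin n →₀ ℕ) (v : VField n) (r : Fin n) :
    coeffVec m v r = coeff m (v r) := rfl

theorem ext_coeffVec {u v : VField n} (h : ∀ m, coeffVec m u = coeffVec m v) : u = v :=
  funext fun r => MvPowerSeries.ext fun m => congrFun (h m) r

theorem coeffVec_pow_matAct (B : Matrix (Fin n) (Fin n) ℝ) (m : Fin n →₀ ℕ) (s : ℕ)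
    (v : VField n) :
    coeffVec m ((matAct B ^ s) v) = ((B.mulVecLin : Module.End ℝ _) ^ s) (coeffVec m v) := by
  induction s with
  | zero => rfl
  | succ s ih =>
    rw [pow_succ', pow_succ', Module.End.mul_apply, Module.End.mul_apply, ← ih]
    funext r
    simp [coeffVec_apply, matAct_apply, Matrix.mulVec, dotProduct]

/-- The formal vector field `f w` of a series `f` and a constant vector `w`. -/
def tens (f : Series n) (w : Fin n → ℝ) : VField n := fun r => w r • f

theorem coeffVec_tens (m : Fin n →₀ ℕ) (f : Series n) (w : Fin n → ℝ) :
    coeffVec m (tens f w) = coeff m f • w := by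
  funext r
  simp [coeffVec_apply, tens, mul_comm]

theorem tens_add_left (f g : Series n) (w : Fin n → ℝ) : tens (f + g) w = tens f w + tens g w :=
  funext fun _ => smul_add _ _ _

theorem tens_smul_left (c : ℝ) (f : Series n) (w : Fin n → ℝ) : tens (c • f) w = c • tens f w :=
  funext fun _ => smul_comm _ _ _

theorem tens_smul_right (c : ℝ) (f : Series n) (w : Fin n → ℝ) : tens f (c • w) = c • tens f w :=
  funext fun _ => by simp [tens, mul_smul]

theorem tens_zero_left (w : Fin n → ℝ) : tens (0 : Series n) w = 0 :=
  funext fun _ => smul_zero _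

theorem tens_zero_right (f : Series n) : tens f (0 : Fin n → ℝ) = 0 :=
  funext fun _ => zero_smul _ _

theorem smul_tens (g f : Series n) (w : Fin n → ℝ) : g • tens f w = tens (g * f) w :=
  funext fun _ => mul_smul_comm _ _ _

theorem pow_matAct_tens (B : Matrix (Fin n) (Fin n) ℝ) (s : ℕ) (f : Series n) (w : Fin n → ℝ) :
    (matAct B ^ s) (tens f w) = tens f (((B.mulVecLin : Module.End ℝ _) ^ s) w) :=
  ext_coeffVec fun m => by rw [coeffVec_pow_matAct, coeffVec_tens, coeffVec_tens, map_smul]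

theorem matAct_tens (B : Matrix (Fin n) (Fin n) ℝ) (f : Series n) (w : Fin n → ℝ) :
    matAct B (tens f w) = tens f (B.mulVecLin w) := by
  simpa using pow_matAct_tens B 1 f w

/-- This is why multiplying by an invariant multiplies the leading term and does not disturb the
filtration. -/
theorem pow_matAct_smul (B : Matrix (Fin n) (Fin n) ℝ) (s : ℕ) (g : Series n) (v : VField n) :
    (matAct B ^ s) (g • v) = g • (matAct B ^ s) v := by
  induction s with
  | zero => rfl
  | succ s ih =>
    rw [pow_succ', Module.End.mul_apply, Module.End.mul_apply, ih]
    funext r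
    simp [matAct_apply, Finset.mul_sum]

/-- The series obtained by applying a linear form to the values of a formal vector field. -/
def contract (ψ : (Fin n → ℝ) →ₗ[ℝ] ℝ) : VField n →ₗ[ℝ] Series n :=
  ∑ r, ψ (Pi.single r 1) • (LinearMap.proj r : VField n →ₗ[ℝ] Series n)

theorem contract_apply (ψ : (Fin n → ℝ) →ₗ[ℝ] ℝ) (v : VField n) :
    contract ψ v = ∑ r, ψ (Pi.single r 1) • v r := by
  simp [contract]

theorem coeff_contract (ψ : (Fin n → ℝ) →ₗ[ℝ] ℝ) (v : VField n) (m : Fin n →₀ ℕ) :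
    coeff m (contract ψ v) = ψ (coeffVec m v) := by
  rw [contract_apply, map_sum]
  conv_rhs => rw [pi_eq_sum_univ' (coeffVec m v), map_sum]
  refine Finset.sum_congr rfl fun r _ => ?_
  rw [map_smul, map_smul, coeffVec_apply, smul_eq_mul, smul_eq_mul, mul_comm]

theorem contract_tens (ψ : (Fin n → ℝ) →ₗ[ℝ] ℝ) (f : Series n) (w : Fin n → ℝ) :
    contract ψ (tens f w) = ψ w • f :=
  MvPowerSeries.ext fun m => by
    rw [coeff_contract, coeffVec_tens, map_smul, map_smul, smul_eq_mul, smul_eq_mul, mul_comm]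

theorem contract_mem_homog (ψ : (Fin n → ℝ) →ₗ[ℝ] ℝ) {d : ℕ} {v : VField n}
    (hv : v ∈ fieldHomog n d) : contract ψ v ∈ homog n d := by
  rw [contract_apply]
  exact Submodule.sum_mem _ fun r _ => Submodule.smul_mem _ _ (mem_fieldHomog.1 hv r)

theorem tens_mem_fieldHomog {d : ℕ} {f : Series n} (hf : f ∈ homog n d) (w : Fin n → ℝ) :
    tens f w ∈ fieldHomog n d :=
  mem_fieldHomog.2 fun _ => Submodule.smul_mem _ _ hf

theorem smul_mem_fieldHomog {d e : ℕ} {g : Series n} {v : VField n} (hg : g ∈ homog n d)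
    (hv : v ∈ fieldHomog n e) : g • v ∈ fieldHomog n (d + e) := by
  classical
  refine mem_fieldHomog.2 fun r => mem_homog.2 fun m hm => ?_
  rw [Pi.smul_apply, smul_eq_mul, coeff_mul]
  refine Finset.sum_eq_zero fun x hx => ?_
  by_cases h1 : x.1.degree = d
  · rw [mem_homog.1 (mem_fieldHomog.1 hv r) x.2 fun h2 => hm ?_, mul_zero]
    rw [← Finset.HasAntidiagonal.mem_antidiagonal.1 hx, map_add, h1, h2]
  · rw [mem_homog.1 hg x.1 h1, zero_mul]

theorem matAct_mem_equivariants {N : Matrix (Fin n) (Fin n) ℝ} {v : VField n}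
    (hv : v ∈ equivariants N) : matAct (-N.transpose) v ∈ equivariants N := by
  rw [mem_equivariants_iff] at hv ⊢
  intro r
  rw [matAct_apply, matAct_apply, map_sum, ← Finset.sum_neg_distrib]
  refine Finset.sum_congr rfl fun c _ => ?_
  rw [hv c, map_smul, smul_neg]

/-- On equivariants, `(-N*) ^ s` acts on values as `(-𝒳) ^ s` acts on components. -/
theorem contract_pow_matAct {N : Matrix (Fin n) (Fin n) ℝ} (ψ : (Fin n → ℝ) →ₗ[ℝ] ℝ) (s : ℕ)
    {v : VField n} (hv : v ∈ equivariants N) :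
    contract ψ ((matAct (-N.transpose) ^ s) v) =
      (-1 : ℝ) ^ s • ((dirDeriv N.transpose : Module.End ℝ (Series n)) ^ s) (contract ψ v) := by
  induction s generalizing v with
  | zero => simp
  | succ s ih =>
    rw [pow_succ, Module.End.mul_apply, ih (matAct_mem_equivariants hv)]
    have : contract ψ (matAct (-N.transpose) v) = -dirDeriv N.transpose (contract ψ v) := by
      simp only [contract_apply, mem_equivariants_iff.1 hv, map_sum, map_smul, smul_neg,
        Finset.sum_neg_distrib]
    rw [this, map_neg, pow_succ (dirDeriv N.transpose : Module.End ℝ (Series n)),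
      Module.End.mul_apply]
    module

theorem smul_mem_equivariants {N : Matrix (Fin n) (Fin n) ℝ} {g : Series n} {v : VField n}
    (hg : g ∈ invariants N) (hv : v ∈ equivariants N) : g • v ∈ equivariants N := by
  rw [mem_equivariants_iff] at hv ⊢
  intro r
  have h1 := congrFun (pow_matAct_smul (-N.transpose) 1 g v) r
  simp only [pow_one, Pi.smul_apply, smul_eq_mul] at h1 ⊢
  rw [h1, hv r, dirDeriv_mul, show dirDeriv N.transpose g = 0 from hg]
  ring

theorem exists_homogeneous_equivariant {N : Matrix (Fin n) (Fin n) ℝ} {v : VField n}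
    (hv : v ∈ equivariants N) (d : ℕ) : ∃ u ∈ equivariants N, u ∈ fieldHomog n d ∧
      ∀ κ : Fin n × (Fin n →₀ ℕ), κ.2.degree = d → fieldCoeff n κ u = fieldCoeff n κ v := by
  refine ⟨fun r => homogeneousComponent d (v r), ?_, mem_fieldHomog.2 fun r =>
    homogeneousComponent_mem_homog d (v r), fun κ hκ => ?_⟩
  · rw [mem_equivariants_iff] at hv ⊢
    intro r
    rw [dirDeriv_homogeneousComponent, ← map_neg, ← hv r, matAct_apply, matAct_apply, map_sum]
    simp only [map_smul]
  · exact (coeff_homogeneousComponent d κ.2 _).trans (if_pos hκ)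

end VectorFields

/-! ### Equivariance and leading terms of transvectants -/

section Transvectants

variable {n : ℕ}

theorem pow_mulVecLin (B : Matrix (Fin n) (Fin n) ℝ) (k : ℕ) (w : Fin n → ℝ) :
    ((B.mulVecLin : Module.End ℝ _) ^ k) w = (B ^ k).mulVec w := by
  induction k with
  | zero => simp
  | succ k ih => rw [pow_succ', pow_succ', Module.End.mul_apply, ih, Matrix.mulVecLin_apply,
      Matrix.mulVec_mulVec]

theorem transvectant_eq (M H : Matrix (Fin n) (Fin n) ℝ) (f : Series n) (w : Fin n → ℝ) (s : ℕ) :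
    transvectant M H f w s = ∑ j ∈ Finset.range (s + 1),
      ((-1 : ℝ) ^ j * transCoeff (seriesWeight H f) (vecWeight H w) s j) •
        tens (((dirDeriv M.transpose : Module.End ℝ (Series n)) ^ j) f)
          ((((-M.transpose).mulVecLin : Module.End ℝ _) ^ (s - j)) w) := by
  simp only [pow_mulVecLin, Module.End.pow_apply (dirDeriv M.transpose)]
  rfl

/-- The recursion that makes neighbouring terms of a transvectant cancel: `(j + 1) (a - j)` is the
factor of `𝒳 𝒴^(j+1) f`, and `(s - j) (b - s + 1 + j)` that of `(-N*) (-M*)^(s-j) w`. -/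
theorem transCoeff_succ {a b s j : ℕ} (ha : s ≤ a) (hb : s ≤ b) (hj : j < s) :
    transCoeff a b s (j + 1) * ((j + 1) * (a - j)) =
      transCoeff a b s j * ((s - j) * (b - s + 1 + j)) := by
  obtain ⟨a, rfl⟩ := Nat.exists_eq_add_of_le ha
  obtain ⟨b, rfl⟩ := Nat.exists_eq_add_of_le hb
  obtain ⟨t, rfl⟩ := Nat.exists_eq_add_of_lt hj
  have h1 := Nat.choose_succ_right_eq (j + t + 1) j
  rw [show j + t + 1 - j = t + 1 by omega] at h1
  have h2 : ((j + t + 1).choose (j + 1) : ℝ) * (j + 1) = (j + t + 1).choose j * (t + 1) := by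
    exact_mod_cast h1
  simp only [transCoeff, show j + t + 1 + a - (j + 1) = t + a by omega,
    show j + t + 1 + a - j = t + a + 1 by omega, show j + t + 1 + b - (j + t + 1) = b by omega,
    ← add_assoc b, Nat.factorial_succ]
  push_cast
  linear_combination (((t + a)! : ℝ) / ((j + t + 1 + a - (j + t + 1))! : ℝ) *
    ((b + j + 1) * ((b + j)! : ℝ) / (b ! : ℝ)) * (t + 1 + a)) * h2

theorem transCoeff_zero_ne_zero (a b s : ℕ) : transCoeff a b s 0 ≠ 0 := by
  simp only [transCoeff, Nat.choose_zero_right]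
  positivity

variable {N M H : Matrix (Fin n) (Fin n) ℝ} {f : Series n} {w : Fin n → ℝ} {s : ℕ}

/-- A well-defined transvectant of top weight vectors is an equivariant. -/
theorem transvectant_mem_equivariants (h : IsSl2Triad N M H) (hf : f ∈ invariants N)
    (hfZ : dirDeriv H.transpose f = (seriesWeight H f : ℝ) • f)
    (hw : (-N.transpose).mulVecLin w = 0)
    (hwZ : (-H.transpose).mulVecLin w = (vecWeight H w : ℝ) • w) (hs : WellDefined H f w s) :
    transvectant M H f w s ∈ equivariants N := by
  have hX : dirDeriv N.transpose f = 0 := hf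
  rw [mem_equivariants_iff]
  intro r
  -- On the left the term `j = s` drops out because `N* w = 0`, on the right the term `j = 0`
  -- because `𝒳 f = 0`. After the index shift, the sums are compared term by term.
  rw [transvectant_eq, map_sum, Finset.sum_range_succ, Finset.sum_apply r (Finset.range (s + 1)),
    Finset.sum_range_succ']
  simp only [map_smul, matAct_tens, Nat.sub_self, pow_zero, Module.End.one_apply, hw,
    tens_zero_right, smul_zero, add_zero, Pi.smul_apply, tens, map_add, hX, map_sum,
    h.dirDeriv.X_pow_Y hX hfZ, Finset.sum_apply]
  rw [← Finset.sum_neg_distrib]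
  refine Finset.sum_congr rfl fun j hj => ?_
  have hjs := Finset.mem_range.1 hj
  obtain ⟨t, rfl⟩ := Nat.exists_eq_add_of_lt hjs
  have h1 := transCoeff_succ hs.1 hs.2 hjs
  rw [show j + t + 1 - j = t + 1 by omega, h.mulVecLin.X_pow_Y hw hwZ,
    show j + t + 1 - (j + 1) = t by omega]
  simp only [Pi.smul_apply, smul_eq_mul, smul_smul, ← neg_smul]
  congr 1
  push_cast at h1
  linear_combination (-(-1) ^ j * (((((-M.transpose).mulVecLin : Module.End ℝ _) ^ t) w) r)) * h1

/-- The coefficient of the leading term of a transvectant, after applying `(-N*) ^ s`. -/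
def leadingCoeff (a b s : ℕ) : ℝ :=
  transCoeff a b s 0 * ∏ j ∈ Finset.range s, (((j : ℝ) + 1) * (b - j))

theorem leadingCoeff_ne_zero {a b s : ℕ} (hs : s ≤ b) : leadingCoeff a b s ≠ 0 := by
  refine mul_ne_zero (transCoeff_zero_ne_zero a b s) (Finset.prod_ne_zero_iff.2 fun j hj => ?_)
  have : (j : ℝ) < b := by exact_mod_cast (Finset.mem_range.1 hj).trans_le hs
  exact mul_ne_zero (by positivity) (sub_ne_zero.2 this.ne')

/-- Only in the term `j = 0` is `w` lowered `s` times, and `(-N*)^s` brings it back to a multiple of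
`w`. In the other terms `w` is lowered fewer than `s` times and is annihilated. -/
theorem pow_matAct_transvectant (h : IsSl2Triad N M H) (hw : (-N.transpose).mulVecLin w = 0)
    (hwZ : (-H.transpose).mulVecLin w = (vecWeight H w : ℝ) • w) :
    (matAct (-N.transpose) ^ s) (transvectant M H f w s) =
      leadingCoeff (seriesWeight H f) (vecWeight H w) s • tens f w := by
  rw [transvectant_eq, map_sum, Finset.sum_range_succ', Finset.sum_eq_zero, zero_add, map_smul,
    pow_matAct_tens, Nat.sub_zero, h.mulVecLin.pow_X_pow_Y_self hw hwZ, tens_smul_right, smul_smul,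
    leadingCoeff]
  · simp
  · intro j hj
    have hjs := Finset.mem_range.1 hj
    rw [map_smul, pow_matAct_tens, h.mulVecLin.pow_X_pow_Y_of_lt hw hwZ (by omega),
      tens_zero_right, smul_zero]

theorem pow_matAct_transvectant_of_lt (h : IsSl2Triad N M H)
    (hw : (-N.transpose).mulVecLin w = 0)
    (hwZ : (-H.transpose).mulVecLin w = (vecWeight H w : ℝ) • w) {t : ℕ} (ht : s < t) :
    (matAct (-N.transpose) ^ t) (transvectant M H f w s) = 0 := by
  obtain ⟨u, rfl⟩ := Nat.exists_eq_add_of_lt ht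
  rw [show s + u + 1 = u + 1 + s by ring, pow_add, Module.End.mul_apply,
    pow_matAct_transvectant h hw hwZ, map_smul, pow_matAct_tens, pow_succ, Module.End.mul_apply, hw,
    map_zero, tens_zero_right, smul_zero]

theorem pow_dirDeriv_mem_homog (A : Matrix (Fin n) (Fin n) ℝ) {d : ℕ} (hf : f ∈ homog n d)
    (j : ℕ) : ((dirDeriv A : Module.End ℝ (Series n)) ^ j) f ∈ homog n d := by
  induction j with
  | zero => exact hf
  | succ j ih =>
    rw [pow_succ', Module.End.mul_apply]
    exact dirDeriv_mem_homog A ih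

theorem transvectant_mem_fieldHomog {d : ℕ} (hf : f ∈ homog n d) :
    transvectant M H f w s ∈ fieldHomog n d := by
  rw [transvectant_eq]
  exact Submodule.sum_mem _ fun j _ => Submodule.smul_mem _ _
    (tens_mem_fieldHomog (pow_dirDeriv_mem_homog _ hf j) _)

end Transvectants

/-! ### Monomials in the Hilbert basis, top vectors and standard sets -/

section Bases

variable {n p q : ℕ}

theorem weight_eq {V : Type*} [AddCommGroup V] [Module ℝ V] {Z : V →ₗ[ℝ] V} {v : V} {m : ℕ}
    (hv : v ≠ 0) (h : Z v = (m : ℝ) • v) : weight Z v = m := by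
  have : {w : ℕ | Z v = (w : ℝ) • v} = {m} := by
    ext w
    simp only [Set.mem_ofPred_eq, Set.mem_singleton_iff]
    refine ⟨fun hw => ?_, fun hw => hw ▸ h⟩
    exact_mod_cast smul_left_injective ℝ hv (hw.symm.trans h)
  rw [weight, this, csInf_singleton]

theorem mono_eq (α : Fin p → MvPolynomial (Fin n) ℝ) (k : Fin p →₀ ℕ) :
    mono α k = ∏ i, (α i : Series n) ^ k i := by
  rw [mono, ← MvPolynomial.coeToMvPowerSeries.ringHom_apply, map_prod]
  simp

theorem mono_add (α : Fin p → MvPolynomial (Fin n) ℝ) (k l : Fin p →₀ ℕ) :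
    mono α (k + l) = mono α k * mono α l := by
  simp only [mono_eq, Finsupp.add_apply, pow_add, Finset.prod_mul_distrib]

variable {N M H : Matrix (Fin n) (Fin n) ℝ} {α : Fin p → MvPolynomial (Fin n) ℝ}

namespace IsHilbertBasis

/-- Additivity of `δ` ensures that a replaced element keeps its degree. -/
theorem exists_degree (hα : IsHilbertBasis N H α) :
    ∃ δ : (Fin p →₀ ℕ) → ℕ,
    (∀ k l, δ (k + l) = δ k + δ l) ∧ ∀ k, mono α k ∈ homog n (δ k) := by
  choose δ hδ using hα.homogeneous
  refine ⟨fun k => ∑ i, δ i * k i, fun k l => ?_, fun k => mem_homog.2 fun m hm => ?_⟩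
  · simp [mul_add, Finset.sum_add_distrib]
  rw [mono, MvPolynomial.coeff_coe]
  exact (MvPolynomial.IsHomogeneous.prod Finset.univ _ _ fun i _ => (hδ i).pow (k i)).coeff_eq_zero
    hm

theorem mono_ne_zero (hα : IsHilbertBasis N H α) (k : Fin p →₀ ℕ) : mono α k ≠ 0 := by
  rw [mono_eq]
  refine Finset.prod_ne_zero_iff.2 fun i _ => pow_ne_zero _ ?_
  obtain ⟨w, hw⟩ := hα.weightVector i
  exact hw.2

theorem mono_mem_invariants (hα : IsHilbertBasis N H α) (k : Fin p →₀ ℕ) :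
    mono α k ∈ invariants N := by
  have hmul : ∀ f g : Series n, f ∈ invariants N → g ∈ invariants N → f * g ∈ invariants N := by
    intro f g hf hg
    simp only [invariants, LinearMap.mem_ker] at hf hg ⊢
    rw [dirDeriv_mul, hf, hg, mul_zero, mul_zero, add_zero]
  have hone : (1 : Series n) ∈ invariants N := dirDeriv_one _
  rw [mono_eq]
  refine Finset.prod_induction _ (· ∈ invariants N) hmul hone fun i _ => ?_
  generalize k i = t
  induction t with
  | zero => simpa using hone
  | succ t ih => rw [pow_succ]; exact hmul _ _ ih (hα.invariant i)

theorem exists_weight_mono (hα : IsHilbertBasis N H α) (k : Fin p →₀ ℕ) :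
    ∃ w : ℝ, dirDeriv H.transpose (mono α k) = w • mono α k := by
  have hmul : ∀ f g : Series n, (∃ w : ℝ, dirDeriv H.transpose f = w • f) →
      (∃ w : ℝ, dirDeriv H.transpose g = w • g) →
      ∃ w : ℝ, dirDeriv H.transpose (f * g) = w • (f * g) := by
    rintro f g ⟨w, hf⟩ ⟨z, hg⟩
    refine ⟨w + z, ?_⟩
    rw [dirDeriv_mul, hf, hg, mul_smul_comm, mul_smul_comm, mul_comm g f]
    module
  have hone : ∃ w : ℝ, dirDeriv H.transpose (1 : Series n) = w • 1 :=
    ⟨0, by rw [dirDeriv_one, zero_smul]⟩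
  rw [mono_eq]
  refine Finset.prod_induction _ (fun f => ∃ w : ℝ, dirDeriv H.transpose f = w • f) hmul hone
    fun i _ => ?_
  generalize k i = t
  induction t with
  | zero => simpa using hone
  | succ t ih =>
    rw [pow_succ]
    obtain ⟨w, hw⟩ := hα.weightVector i
    exact hmul _ _ ih ⟨w, hw.apply_eq_smul⟩

/-- The eigenvalue is a natural number because `𝒴` is nilpotent on the homogeneous piece containing
the monomial; so `seriesWeight` is the true eigenvalue and not its default `0`. -/
theorem dirDeriv_mono (hα : IsHilbertBasis N H α) (h : IsSl2Triad N M H) (k : Fin p →₀ ℕ) :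
    dirDeriv H.transpose (mono α k) = (seriesWeight H (mono α k) : ℝ) • mono α k := by
  obtain ⟨w, hw⟩ := hα.exists_weight_mono k
  obtain ⟨δ, -, hδ⟩ := hα.exists_degree
  obtain ⟨a, ha⟩ := exists_pow_dirDeriv_eq_zero (B := M.transpose) (C := H.transpose)
    (c := -2) (by norm_num) (fun f => LinearMap.congr_fun h.dirDeriv.comm_ZY f) (δ k)
  obtain ⟨m, rfl⟩ := h.dirDeriv.exists_nat_weight (hα.mono_ne_zero k) (hα.mono_mem_invariants k) hw
    (ha _ (hδ k))
  rw [seriesWeight, weight_eq (hα.mono_ne_zero k) hw, hw]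

end IsHilbertBasis

namespace IsTopBasis

variable {b : Fin q → Fin n → ℝ}

theorem mulVecLin_eq_zero (hb : IsTopBasis N H b) (j : Fin q) :
    (-N.transpose).mulVecLin (b j) = 0 := by
  have h1 : b j ∈ LinearMap.ker N.transpose.mulVecLin :=
    hb.span_eq ▸ Submodule.subset_span ⟨j, rfl⟩
  rw [LinearMap.mem_ker, Matrix.mulVecLin_apply] at h1
  rw [Matrix.mulVecLin_apply, Matrix.neg_mulVec, h1, neg_zero]

theorem mem_span (hb : IsTopBasis N H b) {w : Fin n → ℝ}
    (hw : (-N.transpose).mulVecLin w = 0) : w ∈ Submodule.span ℝ (Set.range b) := by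
  rw [hb.span_eq, LinearMap.mem_ker]
  rw [Matrix.mulVecLin_apply, Matrix.neg_mulVec, neg_eq_zero] at hw
  exact hw

theorem mulVecLin_weight (hb : IsTopBasis N H b) (h : IsSl2Triad N M H) (j : Fin q) :
    (-H.transpose).mulVecLin (b j) = (vecWeight H (b j) : ℝ) • b j := by
  obtain ⟨w, hw⟩ := hb.weightVector j
  obtain ⟨a, ha⟩ := isNilpotent_of_commutator_eq_smul (c := -2) (by norm_num) h.mulVecLin.comm_ZY
  obtain ⟨m, rfl⟩ := h.mulVecLin.exists_nat_weight hw.2 (hb.mulVecLin_eq_zero j) hw.apply_eq_smul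
    (LinearMap.congr_fun ha _)
  rw [vecWeight, weight_eq hw.2 hw.apply_eq_smul, hw.apply_eq_smul]

end IsTopBasis

/-- The coordinate forms on the span of `b` are extended to all of `ℝⁿ`, so that they can contract
arbitrary vector fields. -/
theorem exists_dual_family {b : Fin q → Fin n → ℝ} (hb : LinearIndependent ℝ b) :
    ∃ ψ : Fin q → (Fin n → ℝ) →ₗ[ℝ] ℝ, (∀ i j, ψ j (b i) = if i = j then 1 else 0) ∧
      ∀ w ∈ Submodule.span ℝ (Set.range b), w = ∑ j, ψ j w • b j := by
  obtain ⟨g, hg⟩ := LinearMap.exists_leftInverse_of_injective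
    (Finsupp.linearCombination ℝ b) (LinearMap.ker_eq_bot.2 hb)
  have hψ : ∀ i j, (Finsupp.lapply j ∘ₗ g) (b i) = if i = j then (1 : ℝ) else 0 := by
    intro i j
    have h1 := LinearMap.congr_fun hg (Finsupp.single i 1)
    simp only [LinearMap.comp_apply, Finsupp.linearCombination_single, one_smul,
      LinearMap.id_apply] at h1
    rw [LinearMap.comp_apply, h1, Finsupp.lapply_apply, Finsupp.single_apply]
  refine ⟨fun j => Finsupp.lapply j ∘ₗ g, hψ, fun w hw => ?_⟩
  induction hw using Submodule.span_induction with
  | mem x hx =>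
    obtain ⟨i, rfl⟩ := hx
    simp only [hψ, ite_smul, one_smul, zero_smul, Finset.sum_ite_eq, Finset.mem_univ, if_true]
  | zero => simp
  | add x y _ _ hx hy =>
    simp only [map_add, add_smul, Finset.sum_add_distrib]
    rw [← hx, ← hy]
  | smul c x _ hx =>
    simp only [map_smul, smul_assoc, ← Finset.smul_sum]
    rw [← hx]

theorem mem_of_add_mem_standard {A : Set (Fin p →₀ ℕ)} (hA : IsStandardSet A)
    {k l : Fin p →₀ ℕ} (h : k + l ∈ A) : l ∈ A := by
  obtain ⟨S, rfl⟩ := hA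
  intro hl
  refine h ?_
  have := Ideal.mul_mem_left _ (MvPolynomial.monomial k (1 : ℝ)) hl
  rwa [MvPolynomial.monomial_mul, one_mul] at this

end Bases

/-! ### Families with the leading terms of the pre-box product -/

section PreBox

variable {n p q : ℕ} {N M H : Matrix (Fin n) (Fin n) ℝ} {α : Fin p → MvPolynomial (Fin n) ℝ}
  {A : Set (Fin p →₀ ℕ)} {b : Fin q → Fin n → ℝ} {F : preBox H α A b → VField n}
  {κ : preBox H α A b → ℝ}

/-- Equivariants with the leading terms of the pre-box product are linearly independent. -/
theorem linearIndependent_of_leading (hA : IsPreferredSet N α A) (hb : LinearIndependent ℝ b)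
    (hκ : ∀ τ, κ τ ≠ 0)
    (hlead : ∀ τ, (matAct (-N.transpose) ^ τ.1.strength) (F τ) =
      κ τ • tens (mono α τ.1.exponent) (b τ.1.index))
    (hvan : ∀ τ t, τ.1.strength < t → (matAct (-N.transpose) ^ t) (F τ) = 0) :
    LinearIndependent ℝ F := by
  classical
  obtain ⟨ψ, hψ, -⟩ := exists_dual_family hb
  rw [linearIndependent_iff']
  by_contra! hcon
  obtain ⟨T, c, hsum, τ', hτ', hcτ'⟩ := hcon
  -- Applying `(-N*)` to the greatest strength present kills all terms of smaller strength, and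
  -- contraction with the dual form isolates the index of `τ₀`.
  obtain ⟨τ₀, hτ₀, hmax⟩ := (T.filter fun τ => c τ ≠ 0).exists_max_image (fun τ => τ.1.strength)
    ⟨τ', Finset.mem_filter.2 ⟨hτ', hcτ'⟩⟩
  obtain ⟨hτ₀T, hcτ₀⟩ := Finset.mem_filter.1 hτ₀
  let Q : preBox H α A b → Prop := fun τ =>
    τ.1.strength = τ₀.1.strength ∧ τ.1.index = τ₀.1.index
  let u : {τ // Q τ} → Series n := fun τ => mono α τ.1.1.exponent
  -- With strength and index fixed, a label is determined by its exponent.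
  have hu : LinearIndependent ℝ u := by
    refine hA.linearIndependent.comp
      (fun τ : {τ // Q τ} => (⟨τ.1.1.exponent, τ.1.2.mem⟩ : A)) ?_
    rintro ⟨⟨⟨k, j, s⟩, h1⟩, h2, h3⟩ ⟨⟨⟨k', j', s'⟩, h1'⟩, h2', h3'⟩ heq
    simp only [Subtype.mk.injEq, Label.mk.injEq] at *
    exact ⟨heq, h3.trans h3'.symm, h2.trans h2'.symm⟩
  have hterm : ∀ τ ∈ T, c τ • contract (ψ τ₀.1.index)
      ((matAct (-N.transpose) ^ τ₀.1.strength) (F τ)) =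
      if Q τ then (c τ * κ τ) • mono α τ.1.exponent else 0 := by
    intro τ hτ
    by_cases hc0 : c τ = 0
    · simp [hc0]
    rcases (hmax τ (Finset.mem_filter.2 ⟨hτ, hc0⟩)).lt_or_eq with hlt | heq
    · rw [hvan τ _ hlt, map_zero, smul_zero, if_neg fun hQ => hlt.ne hQ.1]
    · have h0 := hlead τ
      rw [heq] at h0
      rw [h0, map_smul, contract_tens, hψ]
      by_cases hj : τ.1.index = τ₀.1.index
      · rw [if_pos hj, if_pos ⟨heq, hj⟩, one_smul, smul_smul]
      · rw [if_neg hj, if_neg fun hQ => hj hQ.2, zero_smul, smul_zero, smul_zero]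
  have h1 := congrArg (fun v => contract (ψ τ₀.1.index)
    ((matAct (-N.transpose) ^ τ₀.1.strength) v)) hsum
  simp only [map_sum, map_smul, map_zero] at h1
  rw [Finset.sum_congr rfl hterm, ← Finset.sum_filter,
    ← Finset.sum_subtype_eq_sum_filter (f := fun τ => (c τ * κ τ) • mono α τ.1.exponent)] at h1
  have h2 := linearIndependent_iff'.1 hu (T.subtype Q) (fun τ => c τ.1 * κ τ.1) h1
    ⟨τ₀, rfl, rfl⟩ (by simpa using hτ₀T)
  exact mul_ne_zero hcτ₀ (hκ τ₀) h2

/-- Homogeneous equivariants with the leading terms of the pre-box product span the homogeneous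
equivariants of each degree. -/
theorem mem_span_of_leading (h : IsSl2Triad N M H) (hα : IsHilbertBasis N H α)
    (hA : IsPreferredSet N α A) (hb : IsTopBasis N H b) {δ : (Fin p →₀ ℕ) → ℕ}
    (hδ : ∀ k, mono α k ∈ homog n (δ k)) (hF : ∀ τ, F τ ∈ equivariants N)
    (hFδ : ∀ τ, F τ ∈ fieldHomog n (δ τ.1.exponent)) (hκ : ∀ τ, κ τ ≠ 0)
    (hlead : ∀ τ, (matAct (-N.transpose) ^ τ.1.strength) (F τ) =
      κ τ • tens (mono α τ.1.exponent) (b τ.1.index))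
    {d : ℕ} (s : ℕ) : ∀ v ∈ equivariants N, v ∈ fieldHomog n d →
      (matAct (-N.transpose) ^ s) v = 0 →
      v ∈ Submodule.span ℝ (F '' {τ | δ τ.1.exponent = d}) := by
  obtain ⟨ψ, hψ, hψspan⟩ := exists_dual_family hb.linearIndependent
  obtain ⟨a, ha⟩ := exists_pow_dirDeriv_eq_zero (B := N.transpose) (C := H.transpose)
    (c := 2) (by norm_num) (fun f => LinearMap.congr_fun h.dirDeriv.comm_ZX f) d
  obtain ⟨a', ha'⟩ := isNilpotent_of_commutator_eq_smul (c := 2) (by norm_num) h.mulVecLin.comm_ZX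
  have hspan : Submodule.span ℝ (F '' {τ | δ τ.1.exponent = d}) ≤
      equivariants N ⊓ fieldHomog n d := by
    rw [Submodule.span_le]
    rintro _ ⟨τ, rfl, rfl⟩
    exact ⟨hF τ, hFδ τ⟩
  induction s with
  | zero => intro v _ _ hv; rw [show v = 0 from hv]; exact Submodule.zero_mem _
  | succ s ih =>
    intro v hvE hvd hv
    set u := (matAct (-N.transpose) ^ s) v with hu
    have hker : ∀ m, coeffVec m u ∈ Submodule.span ℝ (Set.range b) := by
      intro m
      refine hb.mem_span ?_
      have h1 := coeffVec_pow_matAct (-N.transpose) m (s + 1) v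
      rw [hv, map_zero, pow_succ', Module.End.mul_apply, ← coeffVec_pow_matAct] at h1
      exact h1.symm
    have hsum : u = ∑ j, tens (contract (ψ j) u) (b j) := by
      refine ext_coeffVec fun m => ?_
      simp only [map_sum, coeffVec_tens, coeff_contract]
      exact hψspan _ (hker m)
    have hterm : ∀ j, tens (contract (ψ j) u) (b j) ∈
        (Submodule.span ℝ (F '' {τ | δ τ.1.exponent = d})).map (matAct (-N.transpose) ^ s) := by
      intro j
      by_cases hsj : s ≤ vecWeight H (b j)
      · let e : {k : A // δ k.1 = d} → Series n := fun k => mono α k.1.1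
        have he : LinearIndependent ℝ e := hA.linearIndependent.comp _ Subtype.val_injective
        have hg : (-1 : ℝ) ^ s • contract (ψ j) v ∈ homog n d :=
          Submodule.smul_mem _ _ (contract_mem_homog _ hvd)
        have hf : contract (ψ j) u = ((dirDeriv N.transpose : Module.End ℝ (Series n)) ^ s)
            ((-1 : ℝ) ^ s • contract (ψ j) v) := by
          rw [map_smul, hu, contract_pow_matAct _ _ hvE]
        -- One further application of `𝒳` corresponds to `(-N*)^(s+1) v = 0`.
        have hinv : contract (ψ j) u ∈ invariants N := by
          have h1 := contract_pow_matAct (ψ j) (s + 1) hvE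
          rw [hv, map_zero, eq_comm, smul_eq_zero, or_iff_right (by simp), pow_succ',
            Module.End.mul_apply] at h1
          rw [invariants, LinearMap.mem_ker, hf, map_smul, map_smul, h1, smul_zero]
        have hmem : contract (ψ j) u ∈ homog n d := hf ▸ pow_dirDeriv_mem_homog _ hg s
        have hfd : FiniteDimensional ℝ (gradedPart (seriesCoeff n) Finsupp.degree d) :=
          finiteDimensional_homog n d
        have h2 := mem_span_of_isFormalBasis (coef := seriesCoeff n) (dg := Finsupp.degree)
          (deg := fun k : A => δ k.1)
          (fun _ _ => MvPowerSeries.ext) hA (fun k => hδ k.1) d hinv hmem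
        have h3 : (fun k : A => mono α k.1) '' {k | δ k.1 = d} = Set.range e := by
          rw [Set.image_eq_range]; rfl
        rw [h3, hf] at h2
        have h4 := h.dirDeriv.mem_span_of_mem_range_pow (fun f => dirDeriv_mem_homog _) ha he
          (fun k => hα.mono_mem_invariants k.1.1) (fun k => hα.dirDeriv_mono h k.1.1) hg h2
        rw [← hf] at h4
        generalize contract (ψ j) u = f at h4 ⊢
        induction h4 using Submodule.span_induction with
        | mem x hx =>
          obtain ⟨⟨⟨k, hkA⟩, hkd⟩, hks, rfl⟩ := hx
          -- Both weights are at least `s`, so the label is admissible and `F τ` provides the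
          -- leading term.
          let τ : preBox H α A b := ⟨⟨k, j, s⟩, ⟨hks, hsj⟩, hkA⟩
          refine ⟨(κ τ)⁻¹ • F τ, Submodule.smul_mem _ _ (Submodule.subset_span ⟨τ, hkd, rfl⟩), ?_⟩
          rw [map_smul, show s = τ.1.strength from rfl, hlead τ, smul_smul,
            inv_mul_cancel₀ (hκ τ), one_smul]
        | zero => rw [tens_zero_left]; exact Submodule.zero_mem _
        | add x y _ _ hx hy => rw [tens_add_left]; exact Submodule.add_mem _ hx hy
        | smul c x _ hx => rw [tens_smul_left]; exact Submodule.smul_mem _ _ hx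
      -- The values of `u` lie in `ker N*` and in the range of `(-N*)^s`, so they involve only those
      -- `b i` of weight at least `s`, not `b j`.
      · have hzero : contract (ψ j) u = 0 := by
          refine MvPowerSeries.ext fun m => ?_
          rw [coeff_contract, map_zero]
          have h1 := hker m
          rw [hu, coeffVec_pow_matAct] at h1
          have h2 := h.mulVecLin.mem_span_of_mem_range_pow (U := ⊤) (fun _ _ => trivial)
            (fun w _ => LinearMap.congr_fun ha' w) hb.linearIndependent hb.mulVecLin_eq_zero
            (fun j => hb.mulVecLin_weight h j) trivial h1
          rw [← coeffVec_pow_matAct, ← hu] at h2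
          refine (Submodule.span_le (p := LinearMap.ker (ψ j))).2 ?_ h2
          rintro _ ⟨i, hi, rfl⟩
          have hij : i ≠ j := fun hij => hsj (hij ▸ hi)
          simp [hψ, hij]
        rw [hzero, tens_zero_left]
        exact Submodule.zero_mem _
    obtain ⟨y, hy, hyu⟩ : u ∈ (Submodule.span ℝ (F '' {τ | δ τ.1.exponent = d})).map
        (matAct (-N.transpose) ^ s) := by
      rw [hsum]
      exact Submodule.sum_mem _ fun j _ => hterm j
    have hyE := hspan hy
    -- Since `y` has the same image as `v` under `(-N*)^s`, the difference lies one step lower in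
    -- the filtration.
    have h5 := ih (v - y) (Submodule.sub_mem _ hvE hyE.1) (Submodule.sub_mem _ hvd hyE.2)
      (by rw [map_sub, hyu, ← hu, sub_self])
    simpa using Submodule.add_mem _ h5 hy

/-- The family obtained from the pre-box product by replacing each `(α^k, b_j)^(s)` with
`α^{k'} (α^{k''}, b_j)^(s)`, where `k' + k'' = k`, is a formal basis of the equivariants. -/
theorem isFormalBasis_replacement (hNMH : IsSl2Triad N M H) (hα : IsHilbertBasis N H α)
    (hA : IsPreferredSet N α A) (hb : IsTopBasis N H b) (k' k'' : preBox H α A b → (Fin p →₀ ℕ))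
    (hk : ∀ τ, k' τ + k'' τ = τ.1.exponent)
    (hwd : ∀ τ, WellDefined H (mono α (k'' τ)) (b τ.1.index) τ.1.strength) :
    IsFormalBasis (fieldCoeff n) (equivariants N) (fun τ => mono α (k' τ) •
      transvectant M H (mono α (k'' τ)) (b τ.1.index) τ.1.strength) := by
  obtain ⟨δ, hδadd, hδ⟩ := hα.exists_degree
  set F : preBox H α A b → VField n := fun τ => mono α (k' τ) •
    transvectant M H (mono α (k'' τ)) (b τ.1.index) τ.1.strength with hFdef
  -- The factor uses the weight of `α^{k''}`, not of `α^k`; only its being nonzero matters.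
  let κ : preBox H α A b → ℝ := fun τ =>
    leadingCoeff (seriesWeight H (mono α (k'' τ))) (vecWeight H (b τ.1.index)) τ.1.strength
  have hκ : ∀ τ, κ τ ≠ 0 := fun τ => leadingCoeff_ne_zero (hwd τ).2
  have hF : ∀ τ, F τ ∈ equivariants N := fun τ =>
    smul_mem_equivariants (hα.mono_mem_invariants _)
      (transvectant_mem_equivariants hNMH (hα.mono_mem_invariants _) (hα.dirDeriv_mono hNMH _)
        (hb.mulVecLin_eq_zero _) (hb.mulVecLin_weight hNMH _) (hwd τ))
  have hlead : ∀ τ, (matAct (-N.transpose) ^ τ.1.strength) (F τ) =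
      κ τ • tens (mono α τ.1.exponent) (b τ.1.index) := by
    intro τ
    rw [hFdef, pow_matAct_smul, pow_matAct_transvectant hNMH (hb.mulVecLin_eq_zero _)
      (hb.mulVecLin_weight hNMH _), smul_comm, smul_tens, ← mono_add, hk]
  have hvan : ∀ τ t, τ.1.strength < t → (matAct (-N.transpose) ^ t) (F τ) = 0 := by
    intro τ t ht
    rw [hFdef, pow_matAct_smul, pow_matAct_transvectant_of_lt hNMH (hb.mulVecLin_eq_zero _)
      (hb.mulVecLin_weight hNMH _) ht, smul_zero]
  have hFδ : ∀ τ, F τ ∈ fieldHomog n (δ τ.1.exponent) := by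
    intro τ
    rw [← hk τ, hδadd]
    exact smul_mem_fieldHomog (hδ _) (transvectant_mem_fieldHomog (hδ _))
  have hli := linearIndependent_of_leading hA hb.linearIndependent hκ hlead hvan
  obtain ⟨a, ha⟩ := isNilpotent_of_commutator_eq_smul (c := 2) (by norm_num)
    hNMH.mulVecLin.comm_ZX
  have hfd : ∀ d, FiniteDimensional ℝ
      (gradedPart (fieldCoeff n) (fun κ => κ.2.degree) d) := finiteDimensional_fieldHomog n
  refine isFormalBasis_of_span fieldCoeff_separating
    (fun f hf d => exists_homogeneous_equivariant hf d) hFδ hF hli fun d f hf hfd => ?_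
  -- The nilpotency exponent `a` of `-N*` serves for every equivariant, so the filtration exhausts
  -- the space.
  refine mem_span_of_leading hNMH hα hA hb hδ hF hFδ hκ hlead a f hf hfd ?_
  refine ext_coeffVec fun m => ?_
  rw [coeffVec_pow_matAct, ha]
  simp

end PreBox

end Boosting

end

theorem theorem17p6 {n p q : ℕ} (N M H : Matrix (Fin n) (Fin n) ℝ)
    (hNMH : Boosting.IsSl2Triad N M H)
    (α : Fin p → MvPolynomial (Fin n) ℝ) (hα : Boosting.IsHilbertBasis N H α)
    (A : Set (Fin p →₀ ℕ)) (hA : Boosting.IsPreferredSet N α A)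
    (hAstd : Boosting.IsStandardSet A)
    (b : Fin q → Fin n → ℝ) (hb : Boosting.IsTopBasis N H b)
    (k' k'' : Boosting.preBox H α A b → (Fin p →₀ ℕ))
    (hk : ∀ τ, k' τ + k'' τ = τ.1.exponent)
    (hwd : ∀ τ, Boosting.WellDefined H (Boosting.mono α (k'' τ)) (b τ.1.index) τ.1.strength) :
    (∀ τ, Boosting.IsAdmissible H α A b ⟨k'' τ, τ.1.index, τ.1.strength⟩) ∧
    Boosting.IsFormalBasis (Boosting.fieldCoeff n) (Boosting.equivariants N)
      (fun τ => Boosting.mono α (k' τ) •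
        Boosting.transvectant M H (Boosting.mono α (k'' τ)) (b τ.1.index) τ.1.strength) :=
  ⟨fun τ => ⟨hwd τ, Boosting.mem_of_add_mem_standard hAstd (k := k' τ) ((hk τ).symm ▸ τ.2.mem)⟩,
    Boosting.isFormalBasis_replacement hNMH hα hA hb k' k'' hk hwd⟩
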